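/- **Conventions.** Let $(\Omega,\Sigma,\mu)$ be a $\sigma$-finite complete measure space and $L_0(\mu)$ the space of $\mu$-a.e. classes of real-valued measurable functions. A *quasi Köthe function space* $X(\mu)$ is a quasi normed linear space $(X,\|\cdot\|_X)$ of elements of $L_0(\mu)$ such that (I) if $x\in L_0(\mu)$, $y\in X$ and $|x|\le|y|$, then $x\in X$ and $\|x\|_X\le\|y\|_X$; (II) for some $0<t<\infty$, $\|(|x|^t+|y|^t)^{1/t}\|_X\le(\|x\|_X^t+\|y\|_X^t)^{1/t}$ for all $x,y\in X$; (III) every measurable set containing $\mu$-a.e. the supports of all functions in $X$ equals $\Omega$ up to a null set, and $\|x_n\|_X\to\|x\|_X$ whenever $0\le x_n,x\in X$ and $x_n\uparrow x$ $\mu$-a.e. It is *$\sigma$-order continuous* if $\|x_n\|_X\to0$ for every sequence in $X$ with $0\le x_n\downarrow0$ $\mu$-a.e. For $0<r<\infty$, $X$ is *$r$-convex* (resp. *$r$-concave*) if there is $c\ge0$ with $\|(\sum_k|x_k|^r)^{1/r}\|_X\le c(\sum_k\|x_k\|_X^r)^{1/r}$ (resp. $(\sum_k\|x_k\|_X^r)^{1/r}\le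 c\,\|(\sum_k|x_k|^r)^{1/r}\|_X$) for all finite families $x_1,\dots,x_n\in X$; the best constants are $M^{(r)}(X)$ and $M_{(r)}(X)$. Put $X^r:=\{x\in L_0(\mu): |x|^{1/r}\in X\}$. For $z\in L_0(\mu)$ write $\|z\|_X:=\sup\{\|w\|_X: w\in X,\ |w|\le|z|\}\in[0,\infty]$, which is the given quasi norm if $z\in X$. A *homogeneous set* is a set $U$ with a multiplication $[0,\infty)\times U\to U$; a map $f$ between homogeneous sets is *homogeneous* if $f(\lambda x)=\lambda f(x)$ for all $\lambda\ge0$ and all $x$. In quotients, $a/0=\infty$ for $a>0$ and $0/0=0$. **Theorem.** Let $0<r<\infty$, let $X(\mu)$ be an $r$-convex and $Y(\nu)$ an $r$-concave quasi Köthe function space, let $U,V$ be homogeneous sets (for example real vector spaces), and let $T:U\to V$, $\phi:U\to X(\mu)$, $\psi:V\to Y(\nu)$ be homogeneous. Suppose that for all $n$ and all $x_1,\dots,x_n\in U$ $$\Big\|\Big(\sum_{k=1}^n|\psi(Tx_k)|^r\Big)^{1/r}\Big\|_Y\le\Big\|\Big(\sum_{k=1}^n|\phi(x_k)|^r\Big)^{1/r}\Big\|_X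 .$$ Then there are a positive linear functional $\varphi:X^r\to\mathbb R$ and $0\le\omega_2\in L_0(\nu)$ with $$\sup_{\|x\|_X\le1}\varphi(|x|^r)^{1/r}\le M^{(r)}(X),\qquad \sup_{\|y\|_{L_r(\nu)}\le1}\|\omega_2^{1/r}y\|_Y\le M_{(r)}(Y),$$ where moreover $\omega_2^{1/r}y\in Y$ for all $y\in L_r(\nu)$ with $\|y\|_{L_r(\nu)}\le 1$ if $Y$ is complete, such that for all $x\in U$ $$\int\frac{|\psi(Tx)|^r}{\omega_2}\,d\nu\le\varphi(|\phi(x)|^r).$$ If $X(\mu)$ is $\sigma$-order continuous, then for the same $\omega_2$ there is also $0\le\omega_1\in L_0(\mu)$ with $\sup_{\|x\|_X\le1}\|\omega_1^{1/r}x\|_{L_r(\mu)}\le M^{(r)}(X)$ such that for all $x\in U$ $$\int\frac{|\psi(Tx)|^r}{\omega_2}\,d\nu\le\int|\phi(x)|^r\,\omega_1\,d\mu .$$ -/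

import Mathlib

open MeasureTheory Filter Topology
open scoped NNReal ENNReal

/-- The class of `|x| ^ r` in `L₀(μ)`. -/
noncomputable def absPow {Ω : Type*} [MeasurableSpace Ω] {μ : Measure Ω} (r : ℝ)
    (x : Ω →ₘ[μ] ℝ) : Ω →ₘ[μ] ℝ :=
  AEEqFun.compMeasurable (fun t : ℝ => |t| ^ r) (by fun_prop) x

theorem coeFn_absPow {Ω : Type*} [MeasurableSpace Ω] {μ : Measure Ω} (r : ℝ)
    (x : Ω →ₘ[μ] ℝ) : absPow r x =ᵐ[μ] fun a => |x a| ^ r :=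
  AEEqFun.coeFn_compMeasurable _ _ x

/-- The class of `(∑ₖ |xₖ| ^ r) ^ (1 / r)` in `L₀(μ)`. -/
noncomputable def lrSum {Ω : Type*} [MeasurableSpace Ω] {μ : Measure Ω} (r : ℝ) {n : ℕ}
    (x : Fin n → (Ω →ₘ[μ] ℝ)) : Ω →ₘ[μ] ℝ :=
  absPow (1 / r) (∑ k, absPow r (x k))

/-- A quasi Köthe function space over `μ`: a linear space `carrier` of classes in `L₀(μ)` with a
quasi norm `nrm`. Only the values of `nrm` on `carrier` carry information. -/
structure QuasiKothe {Ω : Type*} [MeasurableSpace Ω] (μ : Measure Ω) where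
  carrier : Submodule ℝ (Ω →ₘ[μ] ℝ)
  nrm : (Ω →ₘ[μ] ℝ) → ℝ
  nrm_nonneg : ∀ x ∈ carrier, 0 ≤ nrm x
  nrm_eq_zero_iff : ∀ x ∈ carrier, nrm x = 0 ↔ x = 0
  nrm_smul : ∀ (c : ℝ), ∀ x ∈ carrier, nrm (c • x) = |c| * nrm x
  nrm_add_le : ∃ C : ℝ, ∀ x ∈ carrier, ∀ y ∈ carrier, nrm (x + y) ≤ C * (nrm x + nrm y)
  /-- (I) ideal property and monotonicity of the quasi norm -/
  ideal : ∀ x : Ω →ₘ[μ] ℝ, ∀ y ∈ carrier, |x| ≤ |y| → x ∈ carrier ∧ nrm x ≤ nrm y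
  /-- (II) `t`-convexity with constant one for some `t` -/
  exists_convex : ∃ t : ℝ, 0 < t ∧ ∀ x ∈ carrier, ∀ y ∈ carrier,
    nrm (absPow (1 / t) (absPow t x + absPow t y)) ≤ (nrm x ^ t + nrm y ^ t) ^ (1 / t)
  /-- (III) every set that contains almost everywhere all supports is almost everywhere `Ω` -/
  full_support : ∀ A : Set Ω, MeasurableSet A →
    (∀ x ∈ carrier, ∀ᵐ a ∂μ, x a ≠ 0 → a ∈ A) → μ Aᶜ = 0
  /-- (III) the Fatou property -/
  fatou : ∀ (x : ℕ → (Ω →ₘ[μ] ℝ)) (y : Ω →ₘ[μ] ℝ), (∀ n, x n ∈ carrier) → y ∈ carrier →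
    (∀ n, 0 ≤ x n) → Monotone x → (∀ᵐ a ∂μ, Tendsto (fun n => x n a) atTop (𝓝 (y a))) →
    Tendsto (fun n => nrm (x n)) atTop (𝓝 (nrm y))

namespace QuasiKothe

/-- `c` is an admissible constant of `r`-convexity. -/
def ConvexConst {Ω : Type*} [MeasurableSpace Ω] {μ : Measure Ω} (X : QuasiKothe μ)
    (r c : ℝ) : Prop :=
  0 ≤ c ∧ ∀ (n : ℕ) (x : Fin n → (Ω →ₘ[μ] ℝ)), (∀ k, x k ∈ X.carrier) →
    X.nrm (lrSum r x) ≤ c * (∑ k, X.nrm (x k) ^ r) ^ (1 / r)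

/-- `c` is an admissible constant of `r`-concavity. -/
def ConcaveConst {Ω : Type*} [MeasurableSpace Ω] {μ : Measure Ω} (X : QuasiKothe μ)
    (r c : ℝ) : Prop :=
  0 ≤ c ∧ ∀ (n : ℕ) (x : Fin n → (Ω →ₘ[μ] ℝ)), (∀ k, x k ∈ X.carrier) →
    (∑ k, X.nrm (x k) ^ r) ^ (1 / r) ≤ c * X.nrm (lrSum r x)

/-- `X` is `r`-convex. -/
def IsRConvex {Ω : Type*} [MeasurableSpace Ω] {μ : Measure Ω} (X : QuasiKothe μ)
    (r : ℝ) : Prop :=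
  ∃ c, X.ConvexConst r c

/-- `X` is `r`-concave. -/
def IsRConcave {Ω : Type*} [MeasurableSpace Ω] {μ : Measure Ω} (X : QuasiKothe μ)
    (r : ℝ) : Prop :=
  ∃ c, X.ConcaveConst r c

/-- The best constant `M^{(r)}(X)` of `r`-convexity (used for `r`-convex `X` only). -/
noncomputable def convexityConst {Ω : Type*} [MeasurableSpace Ω] {μ : Measure Ω}
    (X : QuasiKothe μ) (r : ℝ) : ℝ :=
  sInf {c | X.ConvexConst r c}

/-- The best constant `M_{(r)}(X)` of `r`-concavity (used for `r`-concave `X` only). -/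
noncomputable def concavityConst {Ω : Type*} [MeasurableSpace Ω] {μ : Measure Ω}
    (X : QuasiKothe μ) (r : ℝ) : ℝ :=
  sInf {c | X.ConcaveConst r c}

/-- `σ`-order continuity. -/
def SigmaOrderContinuous {Ω : Type*} [MeasurableSpace Ω] {μ : Measure Ω}
    (X : QuasiKothe μ) : Prop :=
  ∀ x : ℕ → (Ω →ₘ[μ] ℝ), (∀ n, x n ∈ X.carrier) → (∀ n, 0 ≤ x n) → Antitone x →
    (∀ᵐ a ∂μ, Tendsto (fun n => x n a) atTop (𝓝 0)) →
    Tendsto (fun n => X.nrm (x n)) atTop (𝓝 0)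

/-- Completeness of the quasi norm. -/
def Complete {Ω : Type*} [MeasurableSpace Ω] {μ : Measure Ω} (X : QuasiKothe μ) : Prop :=
  ∀ x : ℕ → (Ω →ₘ[μ] ℝ), (∀ n, x n ∈ X.carrier) →
    (∀ ε > 0, ∃ N, ∀ m ≥ N, ∀ n ≥ N, X.nrm (x m - x n) < ε) →
    ∃ y ∈ X.carrier, Tendsto (fun n => X.nrm (x n - y)) atTop (𝓝 0)

/-- The canonical extension of the quasi norm to a `[0, ∞]`-valued functional on all of `L₀(μ)`:
`‖z‖ = sup {‖w‖ : w ∈ X, |w| ≤ |z|}`. -/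
noncomputable def extNrm {Ω : Type*} [MeasurableSpace Ω] {μ : Measure Ω} (X : QuasiKothe μ)
    (z : Ω →ₘ[μ] ℝ) : ℝ≥0∞ :=
  ⨆ w ∈ {w : Ω →ₘ[μ] ℝ | w ∈ X.carrier ∧ |w| ≤ |z|}, ENNReal.ofReal (X.nrm w)

theorem extNrm_eq {Ω : Type*} [MeasurableSpace Ω] {μ : Measure Ω} (X : QuasiKothe μ)
    {z : Ω →ₘ[μ] ℝ} (hz : z ∈ X.carrier) : X.extNrm z = ENNReal.ofReal (X.nrm z) := by
  apply le_antisymm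
  · exact iSup₂_le fun w hw => ENNReal.ofReal_le_ofReal (X.ideal w z hz hw.2).2
  · exact le_iSup₂_of_le z ⟨hz, le_rfl⟩ le_rfl

/-- Membership in `X` follows from an almost everywhere domination by a member. -/
theorem mem_of_ae_le {Ω : Type*} [MeasurableSpace Ω] {μ : Measure Ω} (X : QuasiKothe μ)
    {x y : Ω →ₘ[μ] ℝ} (hy : y ∈ X.carrier) (h : ∀ᵐ a ∂μ, |x a| ≤ |y a|) : x ∈ X.carrier := by
  refine (X.ideal x y hy ?_).1
  rw [← AEEqFun.coeFn_le]
  filter_upwards [h, AEEqFun.coeFn_abs x, AEEqFun.coeFn_abs y] with a h1 h2 h3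
  rw [h2, h3]; exact h1

theorem abs_mem {Ω : Type*} [MeasurableSpace Ω] {μ : Measure Ω} (X : QuasiKothe μ)
    {x : Ω →ₘ[μ] ℝ} (hx : x ∈ X.carrier) : |x| ∈ X.carrier := by
  refine X.mem_of_ae_le hx ?_
  filter_upwards [AEEqFun.coeFn_abs x] with a h
  rw [h, abs_abs]

/-- The space `X^r = {x ∈ L₀(μ) : |x| ^ (1 / r) ∈ X}`. -/
noncomputable def power {Ω : Type*} [MeasurableSpace Ω] {μ : Measure Ω} (X : QuasiKothe μ)
    (r : ℝ) (hr : 0 < r) : Submodule ℝ (Ω →ₘ[μ] ℝ) where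
  carrier := {x | absPow (1 / r) x ∈ X.carrier}
  zero_mem' := by
    refine X.mem_of_ae_le X.carrier.zero_mem ?_
    filter_upwards [coeFn_absPow (1 / r) (0 : Ω →ₘ[μ] ℝ),
      AEEqFun.coeFn_zero (μ := μ) (β := ℝ) (α := Ω)] with a h1 h2
    rw [h1, h2]
    simp [Real.zero_rpow (inv_pos.2 hr).ne']
  add_mem' := by
    intro x y hx hy
    have hs : (2 : ℝ) ^ (1 / r) • (|absPow (1 / r) x| + |absPow (1 / r) y|) ∈ X.carrier :=
      X.carrier.smul_mem _ (X.carrier.add_mem (X.abs_mem hx) (X.abs_mem hy))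
    refine X.mem_of_ae_le hs ?_
    filter_upwards [coeFn_absPow (1 / r) (x + y), coeFn_absPow (1 / r) x,
      coeFn_absPow (1 / r) y, AEEqFun.coeFn_add x y,
      AEEqFun.coeFn_smul ((2 : ℝ) ^ (1 / r)) (|absPow (1 / r) x| + |absPow (1 / r) y|),
      AEEqFun.coeFn_add |absPow (1 / r) x| |absPow (1 / r) y|,
      AEEqFun.coeFn_abs (absPow (1 / r) x),
      AEEqFun.coeFn_abs (absPow (1 / r) y)] with a h1 h2 h3 h4 h5 h6 h7 h8
    have hp : 0 ≤ 1 / r := by positivity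
    rw [h1, h4, h5, Pi.smul_apply, h6, Pi.add_apply, Pi.add_apply, h7, h8, h2, h3, smul_eq_mul,
      abs_of_nonneg (by positivity : 0 ≤ |x a + y a| ^ (1 / r)),
      abs_of_nonneg (by positivity : 0 ≤ |x a| ^ (1 / r)),
      abs_of_nonneg (by positivity : 0 ≤ |y a| ^ (1 / r)),
      abs_of_nonneg (by positivity :
        0 ≤ (2 : ℝ) ^ (1 / r) * (|x a| ^ (1 / r) + |y a| ^ (1 / r)))]
    have key : |x a + y a| ≤ 2 * max |x a| |y a| := by
      have := abs_add_le (x a) (y a)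
      have := le_max_left |x a| |y a|
      have := le_max_right |x a| |y a|
      linarith
    calc |x a + y a| ^ (1 / r) ≤ (2 * max |x a| |y a|) ^ (1 / r) :=
          Real.rpow_le_rpow (abs_nonneg _) key hp
      _ = 2 ^ (1 / r) * (max |x a| |y a|) ^ (1 / r) :=
          Real.mul_rpow (by norm_num) (le_max_of_le_left (abs_nonneg _))
      _ ≤ 2 ^ (1 / r) * (|x a| ^ (1 / r) + |y a| ^ (1 / r)) := by
          apply mul_le_mul_of_nonneg_left _ (by positivity)
          have h9 : 0 ≤ |x a| ^ (1 / r) := by positivity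
          have h10 : 0 ≤ |y a| ^ (1 / r) := by positivity
          rcases max_choice |x a| |y a| with h | h <;> rw [h] <;> linarith
  smul_mem' := by
    intro c x hx
    have hs : |c| ^ (1 / r) • absPow (1 / r) x ∈ X.carrier := X.carrier.smul_mem _ hx
    refine X.mem_of_ae_le hs ?_
    filter_upwards [coeFn_absPow (1 / r) (c • x), coeFn_absPow (1 / r) x,
      AEEqFun.coeFn_smul c x,
      AEEqFun.coeFn_smul (|c| ^ (1 / r)) (absPow (1 / r) x)] with a h1 h2 h3 h4
    rw [h1, h4, h3, Pi.smul_apply, Pi.smul_apply, h2, smul_eq_mul, smul_eq_mul, abs_mul,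
      Real.mul_rpow (abs_nonneg _) (abs_nonneg _)]

/-- If `x ∈ X`, then `|x| ^ r ∈ X^r`. -/
theorem absPow_mem_power {Ω : Type*} [MeasurableSpace Ω] {μ : Measure Ω} (X : QuasiKothe μ)
    (r : ℝ) (hr : 0 < r) {x : Ω →ₘ[μ] ℝ} (hx : x ∈ X.carrier) :
    absPow r x ∈ X.power r hr := by
  change absPow (1 / r) (absPow r x) ∈ X.carrier
  refine X.mem_of_ae_le hx ?_
  filter_upwards [coeFn_absPow (1 / r) (absPow r x), coeFn_absPow r x] with a h1 h2
  rw [h1, h2, abs_of_nonneg (by positivity : 0 ≤ |x a| ^ r), ← Real.rpow_mul (abs_nonneg _),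
    mul_one_div_cancel hr.ne', Real.rpow_one, abs_abs]

/-- The map `X → X^r`, `x ↦ |x| ^ r`. -/
noncomputable def toPower {Ω : Type*} [MeasurableSpace Ω] {μ : Measure Ω} (X : QuasiKothe μ)
    (r : ℝ) (hr : 0 < r) (x : X.carrier) : X.power r hr :=
  ⟨absPow r (x : Ω →ₘ[μ] ℝ), X.absPow_mem_power r hr x.2⟩

/-- `X` is closed under `x₁, …, xₙ ↦ (∑ₖ |xₖ| ^ r) ^ (1 / r)`. -/
theorem lrSum_mem {Ω : Type*} [MeasurableSpace Ω] {μ : Measure Ω} (X : QuasiKothe μ)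
    (r : ℝ) (hr : 0 < r) {n : ℕ} (x : Fin n → (Ω →ₘ[μ] ℝ)) (hx : ∀ k, x k ∈ X.carrier) :
    lrSum r x ∈ X.carrier :=
  (X.power r hr).sum_mem fun k _ => X.absPow_mem_power r hr (hx k)

end QuasiKothe

/-! Put p(f) = ‖|f|^(1/r)‖_X^r on `X.power r`, define q in the same way for Y, and let a(x) =
|φ(x)|^r, b(x) = |ψ(Tx)|^r. On positive elements r-convexity says p(∑ fₖ) ≤ M^r ∑ p(fₖ), r-concavity
says ∑ q(gₖ) ≤ M^r q(∑ gₖ) with the constant of Y, and the hypothesis says q(∑ b(xₖ)) ≤ p(∑ a(xₖ)).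
Thus, up to constants, a superadditive functional lies below a subadditive one along the cone of
pairs (a, b). Hahn–Banach on a product space yields positive functionals with Λ₁ ≤ M^r p, q ≤ M^r Λ₂
and Λ₂(b(x)) ≤ Λ₁(a(x)) (`exists_separating_functionals`). Λ₁ is the required functional.

Λ₂ need not be an integral, so it is replaced by its countably additive part. For fixed f this is a
measure absolutely continuous with respect to the base measure (`exists_density`); the density
divided by f does not depend on f, which gives one weight ρ (`exists_weight`). This part lies below
Λ₂, so the comparison with Λ₁ survives. The bound q ≤ M^r Λ₂ survives too: along a suitable sequence
of cut-offs increasing to f, Λ₂ is at most that part plus ε, and q converges by the Fatou property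
(`exists_monotone_le`, `powNrm_le_outer`). Then ω₂ = 1/ρ. If X is σ-order continuous, Λ₁ equals its
countably additive part, whose weight is ω₁. -/

namespace MeasureTheory.AEEqFun

/-! ### Cut-offs, solid spaces and positive functionals. -/

variable {Ω : Type*} [MeasurableSpace Ω] {μ : Measure Ω}

theorem nonneg_iff {f : Ω →ₘ[μ] ℝ} : 0 ≤ f ↔ ∀ᵐ a ∂μ, 0 ≤ f a := by
  rw [← coeFn_le]
  constructor <;> intro h <;>
    filter_upwards [h, coeFn_zero (μ := μ) (β := ℝ) (α := Ω)] with a h1 h2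
  · rwa [h2] at h1
  · rwa [h2]

/-- The class of `f` cut off outside of the measurable set `A`. -/
noncomputable def cut {A : Set Ω} (hA : MeasurableSet A) (f : Ω →ₘ[μ] ℝ) : Ω →ₘ[μ] ℝ :=
  mk (A.indicator f) (f.aestronglyMeasurable.indicator hA)

theorem coeFn_cut {A : Set Ω} (hA : MeasurableSet A) (f : Ω →ₘ[μ] ℝ) :
    cut hA f =ᵐ[μ] A.indicator f :=
  coeFn_mk _ _

/-- A linear space of classes of functions is solid if it contains with every member all classes
that it dominates. -/
def IsSolid (I : Submodule ℝ (Ω →ₘ[μ] ℝ)) : Prop :=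
  ∀ f, ∀ g ∈ I, (∀ᵐ a ∂μ, |f a| ≤ |g a|) → f ∈ I

theorem IsSolid.cut_mem {I : Submodule ℝ (Ω →ₘ[μ] ℝ)} (hI : IsSolid I) {f : Ω →ₘ[μ] ℝ}
    (hf : f ∈ I) {A : Set Ω} (hA : MeasurableSet A) : cut hA f ∈ I := by
  refine hI _ f hf ?_
  filter_upwards [coeFn_cut hA f] with a h
  rw [h]
  by_cases ha : a ∈ A <;> simp [ha]

theorem cut_nonneg {f : Ω →ₘ[μ] ℝ} (hf : 0 ≤ f) {A : Set Ω} (hA : MeasurableSet A) :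
    0 ≤ cut hA f := by
  rw [nonneg_iff] at *
  filter_upwards [coeFn_cut hA f, hf] with a h h1
  rw [h]
  exact Set.indicator_apply_nonneg fun _ => h1

/-- A linear functional is positive on a linear space of classes of functions. -/
def PositiveOn (I : Submodule ℝ (Ω →ₘ[μ] ℝ)) (Λ : (Ω →ₘ[μ] ℝ) →ₗ[ℝ] ℝ) : Prop :=
  ∀ f ∈ I, 0 ≤ f → 0 ≤ Λ f

theorem PositiveOn.mono {I : Submodule ℝ (Ω →ₘ[μ] ℝ)} {Λ : (Ω →ₘ[μ] ℝ) →ₗ[ℝ] ℝ}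
    (hΛ : PositiveOn I Λ) {f g : Ω →ₘ[μ] ℝ} (hf : f ∈ I) (hg : g ∈ I)
    (h : ∀ᵐ a ∂μ, f a ≤ g a) : Λ f ≤ Λ g := by
  have := hΛ (g - f) (I.sub_mem hg hf) (nonneg_iff.2 (by
    filter_upwards [h, coeFn_sub g f] with a h1 h2
    rw [h2]
    exact sub_nonneg.2 h1))
  rw [map_sub] at this
  linarith

/-! ### The countably additive part of a positive functional and its weight. -/

/-- The set function `A ↦ Λ (f · 1_A)`, with the value `∞` at nonmeasurable sets. -/
noncomputable def content (Λ : (Ω →ₘ[μ] ℝ) →ₗ[ℝ] ℝ) (f : Ω →ₘ[μ] ℝ) (A : Set Ω) : ℝ≥0∞ :=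
  ⨅ hA : MeasurableSet A, ENNReal.ofReal (Λ (cut hA f))

theorem content_apply (Λ : (Ω →ₘ[μ] ℝ) →ₗ[ℝ] ℝ) (f : Ω →ₘ[μ] ℝ) {A : Set Ω}
    (hA : MeasurableSet A) : content Λ f A = ENNReal.ofReal (Λ (cut hA f)) :=
  iInf_pos hA

theorem content_of_not_measurableSet (Λ : (Ω →ₘ[μ] ℝ) →ₗ[ℝ] ℝ) (f : Ω →ₘ[μ] ℝ) {A : Set Ω}
    (hA : ¬ MeasurableSet A) : content Λ f A = ∞ :=
  iInf_neg hA

theorem content_of_null (Λ : (Ω →ₘ[μ] ℝ) →ₗ[ℝ] ℝ) (f : Ω →ₘ[μ] ℝ) {A : Set Ω}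
    (hA : MeasurableSet A) (h : μ A = 0) : content Λ f A = 0 := by
  have : cut hA f = 0 := by
    apply AEEqFun.ext
    filter_upwards [coeFn_cut hA f, coeFn_zero (μ := μ) (β := ℝ) (α := Ω),
      measure_eq_zero_iff_ae_notMem.1 h] with a h1 h2 h3
    rw [h1, h2]
    simp [h3]
  rw [content_apply Λ f hA, this, map_zero, ENNReal.ofReal_zero]

theorem content_empty (Λ : (Ω →ₘ[μ] ℝ) →ₗ[ℝ] ℝ) (f : Ω →ₘ[μ] ℝ) : content Λ f ∅ = 0 :=
  content_of_null Λ f .empty measure_empty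

/-- The outer measure that `content Λ f` generates. Its restriction to the measurable sets is the
countably additive part of `content Λ f`. -/
noncomputable def outer (Λ : (Ω →ₘ[μ] ℝ) →ₗ[ℝ] ℝ) (f : Ω →ₘ[μ] ℝ) : OuterMeasure Ω :=
  OuterMeasure.ofFunction (content Λ f) (content_empty Λ f)

section

variable {I : Submodule ℝ (Ω →ₘ[μ] ℝ)} {Λ : (Ω →ₘ[μ] ℝ) →ₗ[ℝ] ℝ}

/-- This is the criterion that makes every measurable set Carathéodory measurable for `outer Λ f`.
-/
theorem content_inter_add_diff (hI : IsSolid I) (hΛ : PositiveOn I Λ) {f : Ω →ₘ[μ] ℝ}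
    (hf : f ∈ I) (h0 : 0 ≤ f) {s : Set Ω} (hs : MeasurableSet s) (t : Set Ω) :
    content Λ f (t ∩ s) + content Λ f (t \ s) ≤ content Λ f t := by
  by_cases ht : MeasurableSet t
  · rw [content_apply Λ f ht, content_apply Λ f (ht.inter hs), content_apply Λ f (ht.diff hs),
      ← ENNReal.ofReal_add (hΛ _ (hI.cut_mem hf _) (cut_nonneg h0 _))
        (hΛ _ (hI.cut_mem hf _) (cut_nonneg h0 _)), ← map_add]
    apply le_of_eq
    congr 2
    apply AEEqFun.ext
    filter_upwards [coeFn_cut ht f, coeFn_cut (ht.inter hs) f, coeFn_cut (ht.diff hs) f,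
      coeFn_add (cut (ht.inter hs) f) (cut (ht.diff hs) f)] with a h1 h2 h3 h4
    rw [h4, Pi.add_apply, h1, h2, h3]
    by_cases ha : a ∈ t <;> by_cases hb : a ∈ s <;> simp [ha, hb]
  · rw [content_of_not_measurableSet Λ f ht]
    exact le_top

theorem outer_univ_le (f : Ω →ₘ[μ] ℝ) : outer Λ f Set.univ ≤ ENNReal.ofReal (Λ f) := by
  refine (OuterMeasure.ofFunction_le _).trans ?_
  rw [content_apply Λ f .univ]
  apply le_of_eq
  congr 2
  apply AEEqFun.ext
  filter_upwards [coeFn_cut .univ f] with a h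
  rw [h, Set.indicator_univ]

/-- The countably additive part of `content Λ f` has a density. -/
theorem exists_density [SigmaFinite μ] (hI : IsSolid I) (hΛ : PositiveOn I Λ) {f : Ω →ₘ[μ] ℝ}
    (hf : f ∈ I) (h0 : 0 ≤ f) :
    ∃ d : Ω → ℝ≥0∞, Measurable d ∧ ∀ A, MeasurableSet A → ∫⁻ a in A, d a ∂μ = outer Λ f A := by
  have hc : ‹MeasurableSpace Ω› ≤ (outer Λ f).caratheodory := fun s hs =>
    OuterMeasure.ofFunction_caratheodory (content_inter_add_diff hI hΛ hf h0 hs)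
  set m : Measure Ω := (outer Λ f).toMeasure hc with hm
  have hmA : ∀ A, MeasurableSet A → m A = outer Λ f A := fun A hA => toMeasure_apply _ hc hA
  have : IsFiniteMeasure m := ⟨by
    rw [hmA _ .univ]
    exact (outer_univ_le f).trans_lt ENNReal.ofReal_lt_top⟩
  have hac : m ≪ μ := Measure.AbsolutelyContinuous.mk fun s hs h => by
    rw [hmA s hs]
    exact le_antisymm ((OuterMeasure.ofFunction_le s).trans (content_of_null Λ f hs h).le) bot_le
  refine ⟨m.rnDeriv μ, Measure.measurable_rnDeriv _ _, fun A hA => ?_⟩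
  rw [← withDensity_apply _ hA, Measure.withDensity_rnDeriv_eq _ _ hac, hmA A hA]

/-- Intersecting a cover of A with A leaves a cover of A, and on each trimmed piece f is at most c
g, so positivity compares the contents term by term. -/
theorem outer_le_mul (hI : IsSolid I) (hΛ : PositiveOn I Λ) {f g : Ω →ₘ[μ] ℝ}
    (hf : f ∈ I) (hg : g ∈ I) {c : ℝ} (hc : 0 < c) {A : Set Ω} (hA : MeasurableSet A)
    (h : ∀ a ∈ A, f a ≤ c * g a) (h0 : 0 ≤ g) :
    outer Λ f A ≤ ENNReal.ofReal c * outer Λ g A := by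
  have hc0 : ENNReal.ofReal c ≠ 0 := (ENNReal.ofReal_pos.2 hc).ne'
  rw [← ENNReal.inv_mul_le_iff hc0 ENNReal.ofReal_ne_top]
  refine le_iInf₂ fun t ht => ?_
  rw [ENNReal.inv_mul_le_iff hc0 ENNReal.ofReal_ne_top, ← ENNReal.tsum_mul_left]
  have hsub : A ⊆ ⋃ n, t n ∩ A := fun a ha => by
    obtain ⟨n, hn⟩ := Set.mem_iUnion.1 (ht ha)
    exact Set.mem_iUnion.2 ⟨n, hn, ha⟩
  refine (iInf₂_le (fun n => t n ∩ A) hsub).trans (ENNReal.tsum_le_tsum fun n => ?_)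
  by_cases htn : MeasurableSet (t n)
  · rw [content_apply Λ g htn, content_apply Λ f (htn.inter hA), ← ENNReal.ofReal_mul hc.le,
      ← smul_eq_mul, ← map_smul]
    refine ENNReal.ofReal_le_ofReal (hΛ.mono (hI.cut_mem hf _)
      (I.smul_mem _ (hI.cut_mem hg _)) ?_)
    filter_upwards [coeFn_cut htn g, coeFn_cut (htn.inter hA) f, coeFn_smul c (cut htn g),
      nonneg_iff.1 h0] with a h1 h2 h3 h4
    rw [h3, Pi.smul_apply, h1, h2, smul_eq_mul]
    by_cases ha : a ∈ t n <;> by_cases hb : a ∈ A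
    · simpa [ha, hb] using h a hb
    · simpa [ha, hb] using mul_nonneg hc.le h4
    · simp [ha]
    · simp [ha]
  · rw [content_of_not_measurableSet Λ g htn, ENNReal.mul_top hc0]
    exact le_top

/-- Only countably many q occur, so a single null set serves all of them; real factors are recovered
later by approximation. -/
theorem density_le_mul [SigmaFinite μ] (hI : IsSolid I) (hΛ : PositiveOn I Λ) {f g : Ω →ₘ[μ] ℝ}
    (hf : f ∈ I) (hg : g ∈ I) (h0 : 0 ≤ g) {d e : Ω → ℝ≥0∞} (hd : Measurable d)
    (he : Measurable e) (hdA : ∀ A, MeasurableSet A → ∫⁻ a in A, d a ∂μ = outer Λ f A)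
    (heA : ∀ A, MeasurableSet A → ∫⁻ a in A, e a ∂μ = outer Λ g A) :
    ∀ᵐ a ∂μ, ∀ q : ℚ, 0 < q → f a ≤ q * g a → d a ≤ ENNReal.ofReal q * e a := by
  rw [ae_all_iff]
  intro q
  by_cases hq : 0 < q
  swap
  · exact Eventually.of_forall fun a h => absurd h hq
  have hq' : (0 : ℝ) < q := by exact_mod_cast hq
  set B : Set Ω := {a | f a ≤ q * g a}
  have hB : MeasurableSet B := measurableSet_le f.measurable (g.measurable.const_mul _)
  have := ae_le_of_forall_setLIntegral_le_of_sigmaFinite (μ := μ.restrict B) (f := d)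
    (g := fun a => ENNReal.ofReal q * e a) hd (fun s hs _ => by
      rw [lintegral_const_mul _ he, Measure.restrict_restrict hs, hdA _ (hs.inter hB),
        heA _ (hs.inter hB)]
      exact outer_le_mul hI hΛ hf hg hq' (hs.inter hB) (fun a ha => ha.2) h0)
  filter_upwards [(ae_restrict_iff' hB).1 this] with a h _ h2
  exact h h2

theorem density_ne_top {f : Ω →ₘ[μ] ℝ} {d : Ω → ℝ≥0∞} (hd : Measurable d)
    (hdA : ∀ A, MeasurableSet A → ∫⁻ a in A, d a ∂μ = outer Λ f A) : ∀ᵐ a ∂μ, d a ≠ ∞ := by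
  have h := hdA _ .univ
  rw [Measure.restrict_univ] at h
  have := ae_lt_top hd (h.trans_lt ((outer_univ_le f).trans_lt ENNReal.ofReal_lt_top)).ne
  exact this.mono fun a ha => ha.ne

/-- In cross-multiplied form this says d / f ≤ e / g. With the roles exchanged it shows that density
over function is the same for all functions, which is what makes a common weight possible. It
follows by letting the rational q of `density_le_mul` approach f / g. -/
theorem density_mul_le [SigmaFinite μ] (hI : IsSolid I) (hΛ : PositiveOn I Λ) {f g : Ω →ₘ[μ] ℝ}
    (hf : f ∈ I) (hg : g ∈ I) (hf0 : 0 ≤ f) (h0 : 0 ≤ g) {d e : Ω → ℝ≥0∞} (hd : Measurable d)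
    (he : Measurable e) (hdA : ∀ A, MeasurableSet A → ∫⁻ a in A, d a ∂μ = outer Λ f A)
    (heA : ∀ A, MeasurableSet A → ∫⁻ a in A, e a ∂μ = outer Λ g A) :
    ∀ᵐ a ∂μ, d a * ENNReal.ofReal (g a) ≤ e a * ENNReal.ofReal (f a) := by
  filter_upwards [density_le_mul hI hΛ hf hg h0 hd he hdA heA, density_ne_top hd hdA,
    density_ne_top he heA, nonneg_iff.1 hf0, nonneg_iff.1 h0] with a h hd' he' hf' hg'
  lift d a to ℝ≥0 using hd' with x
  lift e a to ℝ≥0 using he' with y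
  have h1 : ∀ q : ℚ, 0 < q → f a ≤ q * g a → (x : ℝ) ≤ q * y := by
    intro q hq hfq
    have h2 := h q hq hfq
    have hq' : (0 : ℝ) ≤ q := by exact_mod_cast hq.le
    rw [← ENNReal.ofReal_coe_nnreal, ← ENNReal.ofReal_coe_nnreal, ← ENNReal.ofReal_mul hq'] at h2
    exact (ENNReal.ofReal_le_ofReal_iff (by positivity)).1 h2
  rw [← ENNReal.ofReal_coe_nnreal, ← ENNReal.ofReal_coe_nnreal, ← ENNReal.ofReal_mul (by positivity),
    ← ENNReal.ofReal_mul (by positivity)]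
  apply ENNReal.ofReal_le_ofReal
  rcases hg'.eq_or_lt with hg1 | hg1
  · rw [← hg1]
    simp only [mul_zero]
    positivity
  by_contra! hcon
  have hx : 0 < (x : ℝ) := by
    by_contra! hx
    have : (x : ℝ) = 0 := le_antisymm hx x.2
    rw [this, zero_mul] at hcon
    exact absurd hcon (not_lt.2 (by positivity))
  -- If e vanishes, any rational above f / g forces d = 0; otherwise a rational strictly between f /
  -- g and d / e gives the contradiction.
  rcases (y.2 : (0 : ℝ) ≤ y).eq_or_lt with hy | hy
  · obtain ⟨q, hq⟩ := exists_rat_gt (max 0 (f a / g a))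
    have hq0 : (0 : ℝ) < q := (le_max_left _ _).trans_lt hq
    have := h1 q (by exact_mod_cast hq0)
      ((div_le_iff₀ hg1).1 ((le_max_right _ _).trans hq.le))
    have hy' : (y : ℝ) = 0 := hy.symm
    rw [hy', mul_zero] at this
    linarith
  · have hy : (0 : ℝ) < y := hy
    have : f a / g a < x / y := by
      rw [div_lt_div_iff₀ hg1 hy]
      linarith
    obtain ⟨q, hq1, hq2⟩ := exists_rat_btwn this
    have hq0 : (0 : ℝ) < q := lt_of_le_of_lt (by positivity) hq1
    have := h1 q (by exact_mod_cast hq0) ((div_le_iff₀ hg1).1 hq1.le)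
    rw [lt_div_iff₀ hy] at hq2
    linarith

/-- Where f = 0 one has f ≤ f / 2, hence d ≤ d / 2, and d is finite almost everywhere. -/
theorem density_eq_zero [SigmaFinite μ] (hI : IsSolid I) (hΛ : PositiveOn I Λ) {f : Ω →ₘ[μ] ℝ}
    (hf : f ∈ I) (h0 : 0 ≤ f) {d : Ω → ℝ≥0∞} (hd : Measurable d)
    (hdA : ∀ A, MeasurableSet A → ∫⁻ a in A, d a ∂μ = outer Λ f A) :
    ∀ᵐ a ∂μ, f a = 0 → d a = 0 := by
  filter_upwards [density_le_mul hI hΛ hf hf h0 hd hd hdA hdA, density_ne_top hd hdA]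
    with a h hd' hfa
  have := h (1 / 2) (by norm_num) (by rw [hfa, mul_zero])
  lift d a to ℝ≥0 using hd' with x
  rw [← ENNReal.ofReal_coe_nnreal, ← ENNReal.ofReal_mul (by norm_num)] at this
  have := (ENNReal.ofReal_le_ofReal_iff (by positivity)).1 this
  push_cast at this
  have hx : (x : ℝ) = 0 := le_antisymm (by linarith) x.2
  exact_mod_cast hx

/-- A solid space of classes has countably many members whose supports cover all supports. -/
theorem IsSolid.exists_countable_support [SigmaFinite μ] (hI : IsSolid I) :
    ∃ e : ℕ → Ω →ₘ[μ] ℝ, (∀ n, e n ∈ I) ∧ (∀ n, 0 ≤ e n) ∧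
      ∀ f ∈ I, ∀ᵐ a ∂μ, f a ≠ 0 → ∃ n, e n a ≠ 0 := by
  obtain ⟨D, hDI, hDc, hD⟩ := Measure.exists_ae_subset_biUnion_countable μ
    (C := (fun f : Ω →ₘ[μ] ℝ => {a | f a ≠ 0}) '' I) (by
      rintro _ ⟨f, -, rfl⟩
      exact (measurableSet_eq_fun f.measurable measurable_const).compl)
  -- The support of the zero class is added so that the countable family is nonempty and can be
  -- enumerated by ℕ.
  obtain ⟨u, hu⟩ := (hDc.insert {a | (0 : Ω →ₘ[μ] ℝ) a ≠ 0}).exists_eq_range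
    (Set.insert_nonempty _ _)
  have hmem : ∀ n, ∃ f ∈ I, {a | f a ≠ 0} = u n := fun n => by
    have : u n ∈ insert {a | (0 : Ω →ₘ[μ] ℝ) a ≠ 0} D := hu ▸ Set.mem_range_self n
    rcases this with h | h
    · exact ⟨0, I.zero_mem, h.symm⟩
    · exact hDI h
  choose e he heu using hmem
  refine ⟨fun n => |e n|, fun n => hI _ _ (he n) ?_, fun n => nonneg_iff.2 ?_, fun f hf => ?_⟩
  · filter_upwards [coeFn_abs (e n)] with a h
    rw [h, abs_abs]
  · filter_upwards [coeFn_abs (e n)] with a h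
    rw [h]
    exact abs_nonneg _
  · have habs : ∀ᵐ a ∂μ, ∀ n, |e n| a = |e n a| := ae_all_iff.2 fun n => coeFn_abs (e n)
    filter_upwards [hD _ ⟨f, hf, rfl⟩, habs] with a h h1 hfa
    obtain ⟨s, hs, has⟩ := h hfa
    have : s ∈ Set.range u := hu ▸ Set.mem_insert_of_mem _ hs
    obtain ⟨n, rfl⟩ := this
    rw [← heu n] at has
    exact ⟨n, by rw [h1]; exact abs_ne_zero.2 has⟩

/-- Up to an arbitrarily small error, the mass of the countably additive part of `Λ` at `f` is an
upper bound for `Λ` along a sequence that increases to `f`. -/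
theorem exists_monotone_le (hI : IsSolid I) (hΛ : PositiveOn I Λ) {f : Ω →ₘ[μ] ℝ}
    (hf : f ∈ I) (h0 : 0 ≤ f) {ε : ℝ} (hε : 0 < ε) :
    ∃ A : ℕ → Set Ω, ∃ hA : ∀ n, MeasurableSet (A n), Monotone A ∧ ⋃ n, A n = Set.univ ∧
      ∀ n, Λ (cut (hA n) f) ≤ (outer Λ f Set.univ).toReal + ε := by
  have hfin : outer Λ f Set.univ ≠ ∞ :=
    ((outer_univ_le f).trans_lt ENNReal.ofReal_lt_top).ne
  have hlt : outer Λ f Set.univ < outer Λ f Set.univ + ENNReal.ofReal ε :=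
    ENNReal.lt_add_right hfin (ENNReal.ofReal_pos.2 hε).ne'
  -- An almost optimal countable cover of Ω; the sets A n are its finite partial unions.
  obtain ⟨t, ht⟩ := iInf_lt_iff.1 hlt
  obtain ⟨htu, hts⟩ := iInf_lt_iff.1 ht
  -- The content is ∞ off the measurable sets, so a cover of finite total content consists of
  -- measurable sets.
  have htm : ∀ n, MeasurableSet (t n) := fun n => by
    by_contra hn
    have := ENNReal.le_tsum (f := fun n => content Λ f (t n)) n
    rw [content_of_not_measurableSet Λ f hn] at this
    exact absurd (this.trans_lt hts) (by simp)
  have hAm : ∀ n, MeasurableSet (⋃ k ∈ Finset.range n, t k) := fun n =>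
    Finset.measurableSet_biUnion _ fun k _ => htm k
  refine ⟨fun n => ⋃ k ∈ Finset.range n, t k, hAm, ?_, ?_, ?_⟩
  · intro m n hmn
    exact Set.biUnion_subset_biUnion_left fun k hk => Finset.range_mono hmn hk
  · refine Set.eq_univ_of_forall fun a => ?_
    obtain ⟨k, hk⟩ := Set.mem_iUnion.1 (htu (Set.mem_univ a))
    exact Set.mem_iUnion.2 ⟨k + 1, Set.mem_biUnion (Finset.self_mem_range_succ k) hk⟩
  · intro n
    have h1 : Λ (cut (hAm n) f) ≤ ∑ k ∈ Finset.range n, Λ (cut (htm k) f) := by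
      rw [← map_sum]
      refine hΛ.mono (hI.cut_mem hf _) (I.sum_mem fun k _ => hI.cut_mem hf _) ?_
      have h' : ∀ᵐ a ∂μ, ∀ k, cut (htm k) f a = (t k).indicator f a :=
        ae_all_iff.2 fun k => coeFn_cut (htm k) f
      filter_upwards [h', coeFn_cut (hAm n) f, nonneg_iff.1 h0,
        coeFn_fun_finsetSum (Finset.range n) fun k => cut (htm k) f] with a h2 h3 h4 h5
      rw [h3, h5]
      have hnn : ∀ k ∈ Finset.range n, 0 ≤ cut (htm k) f a := fun k _ => by
        rw [h2]
        exact Set.indicator_apply_nonneg fun _ => h4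
      by_cases ha : a ∈ ⋃ k ∈ Finset.range n, t k
      · rw [Set.indicator_of_mem ha]
        obtain ⟨k, hk, hak⟩ := Set.mem_iUnion₂.1 ha
        refine le_trans (le_of_eq ?_) (Finset.single_le_sum hnn hk)
        rw [h2, Set.indicator_of_mem hak]
      · rw [Set.indicator_of_notMem ha]
        exact Finset.sum_nonneg hnn
    refine h1.trans ?_
    rw [← ENNReal.ofReal_le_ofReal_iff (by positivity),
      ENNReal.ofReal_add ENNReal.toReal_nonneg hε.le, ENNReal.ofReal_toReal hfin,
      ENNReal.ofReal_sum_of_nonneg fun k _ => hΛ _ (hI.cut_mem hf _) (cut_nonneg h0 _)]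
    refine le_trans (le_trans (le_of_eq ?_) (ENNReal.sum_le_tsum (Finset.range n))) hts.le
    exact Finset.sum_congr rfl fun k _ => (content_apply Λ f (htm k)).symm

/-- The countably additive part of a positive linear functional on a solid space of classes is
given by a weight. -/
theorem exists_weight [SigmaFinite μ] (hI : IsSolid I) (hΛ : PositiveOn I Λ) :
    ∃ (ρ : Ω → ℝ≥0∞) (e : ℕ → Ω →ₘ[μ] ℝ), Measurable ρ ∧ (∀ n, e n ∈ I) ∧
      (∀ᵐ a ∂μ, ρ a ≠ 0 → ∃ n, e n a ≠ 0) ∧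
      ∀ f ∈ I, 0 ≤ f → (∀ᵐ a ∂μ, f a ≠ 0 → ρ a ≠ ∞) ∧
        ∀ A, MeasurableSet A → ∫⁻ a in A, ρ a * ENNReal.ofReal (f a) ∂μ = outer Λ f A := by
  obtain ⟨e, heI, he0, he⟩ := hI.exists_countable_support
  choose d hdm hd using fun n => exists_density hI hΛ (heI n) (he0 n)
  -- Almost everywhere the quotients agree for all n with e n ≠ 0; where e n = 0 also d n = 0, and 0
  -- / 0 = 0 does not affect the supremum.
  refine ⟨fun a => ⨆ n, d n a / ENNReal.ofReal (e n a), e, ?_, heI, ?_, ?_⟩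
  · exact Measurable.iSup fun n => (hdm n).div (e n).measurable.ennreal_ofReal
  · have h1 : ∀ᵐ a ∂μ, ∀ n, e n a = 0 → d n a = 0 :=
      ae_all_iff.2 fun n => density_eq_zero hI hΛ (heI n) (he0 n) (hdm n) (hd n)
    filter_upwards [h1] with a h1
    contrapose!
    intro h2
    simp only [ENNReal.iSup_eq_zero]
    intro n
    rw [h1 n (h2 n), ENNReal.zero_div]
  · intro f hf h0
    obtain ⟨g, hgm, hg⟩ := exists_density hI hΛ hf h0
    have key : ∀ᵐ a ∂μ, (f a = 0 → g a = 0) ∧ g a ≠ ∞ ∧ 0 ≤ f a ∧ (f a ≠ 0 →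
        ⨆ n, d n a / ENNReal.ofReal (e n a) = g a / ENNReal.ofReal (f a)) := by
      have h1 : ∀ᵐ a ∂μ, ∀ n, e n a = 0 → d n a = 0 :=
        ae_all_iff.2 fun n => density_eq_zero hI hΛ (heI n) (he0 n) (hdm n) (hd n)
      have h2 : ∀ᵐ a ∂μ, ∀ n,
          d n a * ENNReal.ofReal (f a) ≤ g a * ENNReal.ofReal (e n a) :=
        ae_all_iff.2 fun n => density_mul_le hI hΛ (heI n) hf (he0 n) h0 (hdm n) hgm (hd n) hg
      have h3 : ∀ᵐ a ∂μ, ∀ n,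
          g a * ENNReal.ofReal (e n a) ≤ d n a * ENNReal.ofReal (f a) :=
        ae_all_iff.2 fun n => density_mul_le hI hΛ hf (heI n) h0 (he0 n) hgm (hdm n) hg (hd n)
      have h4 : ∀ᵐ a ∂μ, ∀ n, 0 ≤ e n a := ae_all_iff.2 fun n => nonneg_iff.1 (he0 n)
      filter_upwards [h1, h2, h3, h4, density_eq_zero hI hΛ hf h0 hgm hg,
        density_ne_top hgm hg, nonneg_iff.1 h0, he f hf] with a h1 h2 h3 h4 h5 h6 h7 h8
      refine ⟨h5, h6, h7, fun hfa => ?_⟩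
      have hfp : ENNReal.ofReal (f a) ≠ 0 :=
        (ENNReal.ofReal_pos.2 (lt_of_le_of_ne h7 (Ne.symm hfa))).ne'
      have heq : ∀ n, e n a ≠ 0 →
          d n a / ENNReal.ofReal (e n a) = g a / ENNReal.ofReal (f a) := fun n hn => by
        have hep : ENNReal.ofReal (e n a) ≠ 0 :=
          (ENNReal.ofReal_pos.2 (lt_of_le_of_ne (h4 n) (Ne.symm hn))).ne'
        rw [ENNReal.div_eq_div_iff hfp ENNReal.ofReal_ne_top hep ENNReal.ofReal_ne_top,
          mul_comm, mul_comm _ (g a)]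
        exact le_antisymm (h2 n) (h3 n)
      apply le_antisymm
      · refine iSup_le fun n => ?_
        by_cases hn : e n a = 0
        · rw [h1 n hn, ENNReal.zero_div]
          exact bot_le
        · exact (heq n hn).le
      · obtain ⟨n, hn⟩ := h8 hfa
        rw [← heq n hn]
        exact le_iSup (fun n => d n a / ENNReal.ofReal (e n a)) n
    constructor
    · filter_upwards [key] with a ⟨h1, h2, h3, h4⟩ hfa
      rw [h4 hfa]
      exact ENNReal.div_ne_top h2 (ENNReal.ofReal_pos.2 (lt_of_le_of_ne h3 (Ne.symm hfa))).ne'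
    · intro A hA
      rw [← hg A hA]
      refine lintegral_congr_ae (ae_restrict_of_ae ?_)
      filter_upwards [key] with a ⟨h1, h2, h3, h4⟩
      by_cases hfa : f a = 0
      · rw [h1 hfa, hfa, ENNReal.ofReal_zero, mul_zero]
      · rw [h4 hfa, ENNReal.div_mul_cancel
          (ENNReal.ofReal_pos.2 (lt_of_le_of_ne h3 (Ne.symm hfa))).ne' ENNReal.ofReal_ne_top]

end

end MeasureTheory.AEEqFun

/-! ### Hahn–Banach for a cone of bounds, and cones as additive closures. -/

/-- Hahn–Banach: a convex cone of upper bounds `(v, s)` that bounds every vector and is consistent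
at `0` is respected by a linear functional. -/
theorem exists_linearMap_le_of_cone {E : Type*} [AddCommGroup E] [Module ℝ E] (D : E → ℝ → Prop)
    (hadd : ∀ v w s t, D v s → D w t → D (v + w) (s + t))
    (hsmul : ∀ c : ℝ, 0 < c → ∀ v s, D v s → D (c • v) (c * s))
    (htot : ∀ v, ∃ s, D v s) (hpos : ∀ s, D 0 s → 0 ≤ s) :
    ∃ L : E →ₗ[ℝ] ℝ, ∀ v s, D v s → L v ≤ s := by
  -- The infimum of the admissible bounds of v is a finite sublinear functional; finiteness from
  -- below comes from a bound for -v and consistency at 0.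
  have hbdd : ∀ v, BddBelow {s | D v s} := fun v => by
    obtain ⟨t, ht⟩ := htot (-v)
    refine ⟨-t, fun s hs => ?_⟩
    have := hpos (s + t) (by simpa using hadd _ _ _ _ hs ht)
    linarith
  have hle : ∀ c : ℝ, 0 < c → ∀ v, sInf {s | D (c • v) s} ≤ c * sInf {s | D v s} := by
    intro c hc v
    rw [← inv_mul_le_iff₀ hc]
    refine le_csInf (htot v) fun s hs => ?_
    rw [inv_mul_le_iff₀ hc]
    exact csInf_le (hbdd _) (hsmul c hc v s hs)
  have hhom : ∀ c : ℝ, 0 < c → ∀ v, sInf {s | D (c • v) s} = c * sInf {s | D v s} := by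
    refine fun c hc v => le_antisymm (hle c hc v) ?_
    have := hle c⁻¹ (inv_pos.2 hc) (c • v)
    rw [inv_smul_smul₀ hc.ne'] at this
    rwa [← le_inv_mul_iff₀ hc]
  have hsub : ∀ v w, sInf {s | D (v + w) s} ≤ sInf {s | D v s} + sInf {s | D w s} := by
    intro v w
    rw [← sub_le_iff_le_add]
    refine le_csInf (htot v) fun s hs => ?_
    rw [sub_le_iff_le_add, ← sub_le_iff_le_add']
    refine le_csInf (htot w) fun t ht => ?_
    rw [sub_le_iff_le_add']
    exact csInf_le (hbdd _) (hadd _ _ _ _ hs ht)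
  have hbot : ∀ x : (⊥ : E →ₗ.[ℝ] ℝ).domain, (⊥ : E →ₗ.[ℝ] ℝ) x ≤ sInf {s | D (x : E) s} := by
    rintro ⟨x, hx⟩
    obtain rfl : x = 0 := hx
    exact Real.sInf_nonneg hpos
  obtain ⟨L, -, hL⟩ := exists_extension_of_le_sublinear (⊥ : E →ₗ.[ℝ] ℝ)
    (fun v => sInf {s | D v s}) hhom hsub hbot
  exact ⟨L, fun v s hs => (hL v).trans (csInf_le (hbdd v) hs)⟩

theorem AddSubmonoid.exists_sum_of_mem_closure_range {S M : Type*} [AddCommMonoid M] {h : S → M}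
    {m : M} (hm : m ∈ AddSubmonoid.closure (Set.range h)) :
    ∃ (n : ℕ) (x : Fin n → S), m = ∑ k, h (x k) := by
  induction hm using AddSubmonoid.closure_induction with
  | mem m hm =>
    obtain ⟨s, rfl⟩ := hm
    exact ⟨1, fun _ => s, by simp⟩
  | zero => exact ⟨0, Fin.elim0, by simp⟩
  | add m₁ m₂ _ _ h₁ h₂ =>
    obtain ⟨n₁, x₁, rfl⟩ := h₁
    obtain ⟨n₂, x₂, rfl⟩ := h₂
    exact ⟨n₁ + n₂, Fin.append x₁ x₂, by simp [Fin.sum_univ_add]⟩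

/-- Since multiples of generators are generators, additive closures already serve as convex cones
and sums need no coefficients. -/
theorem AddSubmonoid.smul_mem_closure_range {S M : Type*} [AddCommGroup M] [Module ℝ M]
    {h : S → M} {c : ℝ} (hc : ∀ s, ∃ s', h s' = c • h s) {m : M}
    (hm : m ∈ AddSubmonoid.closure (Set.range h)) :
    c • m ∈ AddSubmonoid.closure (Set.range h) := by
  induction hm using AddSubmonoid.closure_induction with
  | mem m hm =>
    obtain ⟨s, rfl⟩ := hm
    obtain ⟨s', hs'⟩ := hc s
    exact hs' ▸ AddSubmonoid.subset_closure ⟨s', rfl⟩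
  | zero => simp
  | add m₁ m₂ _ _ h₁ h₂ => rw [smul_add]; exact add_mem h₁ h₂

/-! ### Order on L₀ and the functional `powNrm` on the power space. -/

section

variable {Ω : Type*} [MeasurableSpace Ω] {μ : Measure Ω}

namespace MeasureTheory.AEEqFun

instance isOrderedAddMonoid_real : IsOrderedAddMonoid (Ω →ₘ[μ] ℝ) where
  add_le_add_left f g h k := by
    rw [← coeFn_le] at *
    filter_upwards [h, coeFn_add f k, coeFn_add g k] with a h1 h2 h3
    rw [h2, h3]
    exact add_le_add_left h1 _

theorem smul_le_smul_of_nonneg_left_real {c : ℝ} (hc : 0 ≤ c) {f g : Ω →ₘ[μ] ℝ} (h : f ≤ g) :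
    c • f ≤ c • g := by
  rw [← coeFn_le] at *
  filter_upwards [h, coeFn_smul c f, coeFn_smul c g] with a h1 h2 h3
  rw [h2, h3]
  exact mul_le_mul_of_nonneg_left h1 hc

theorem abs_le_abs_iff_ae {f g : Ω →ₘ[μ] ℝ} : |f| ≤ |g| ↔ ∀ᵐ a ∂μ, |f a| ≤ |g a| := by
  rw [← coeFn_le]
  constructor <;> intro h <;>
    filter_upwards [h, coeFn_abs f, coeFn_abs g] with a h1 h2 h3
  · rwa [h2, h3] at h1
  · rwa [h2, h3]

end MeasureTheory.AEEqFun

open MeasureTheory.AEEqFun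

theorem absPow_nonneg (r : ℝ) (f : Ω →ₘ[μ] ℝ) : 0 ≤ absPow r f := by
  rw [nonneg_iff]
  filter_upwards [coeFn_absPow r f] with a h
  rw [h]
  positivity

theorem absPow_le_absPow {r : ℝ} (hr : 0 ≤ r) {f g : Ω →ₘ[μ] ℝ}
    (h : ∀ᵐ a ∂μ, |f a| ≤ |g a|) : absPow r f ≤ absPow r g := by
  rw [← coeFn_le]
  filter_upwards [coeFn_absPow r f, coeFn_absPow r g, h] with a h1 h2 h3
  rw [h1, h2]
  exact Real.rpow_le_rpow (abs_nonneg _) h3 hr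

theorem absPow_smul (r c : ℝ) (f : Ω →ₘ[μ] ℝ) : absPow r (c • f) = |c| ^ r • absPow r f := by
  apply AEEqFun.ext
  filter_upwards [coeFn_absPow r (c • f), coeFn_absPow r f, coeFn_smul c f,
    coeFn_smul (|c| ^ r) (absPow r f)] with a h1 h2 h3 h4
  rw [h1, h4, h3, Pi.smul_apply, Pi.smul_apply, h2, smul_eq_mul, smul_eq_mul, abs_mul,
    Real.mul_rpow (abs_nonneg _) (abs_nonneg _)]

theorem absPow_absPow {r s : ℝ} (hrs : r * s = 1) (f : Ω →ₘ[μ] ℝ) :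
    absPow s (absPow r f) = |f| := by
  apply AEEqFun.ext
  filter_upwards [coeFn_absPow s (absPow r f), coeFn_absPow r f, coeFn_abs f] with a h1 h2 h3
  rw [h1, h2, h3, abs_of_nonneg (by positivity : 0 ≤ |f a| ^ r), ← Real.rpow_mul (abs_nonneg _),
    hrs, Real.rpow_one]

namespace QuasiKothe

theorem nrm_abs (X : QuasiKothe μ) {x : Ω →ₘ[μ] ℝ} (hx : x ∈ X.carrier) : X.nrm |x| = X.nrm x :=
  le_antisymm (X.ideal _ _ hx (abs_abs x).le).2 (X.ideal _ _ (X.abs_mem hx) (abs_abs x).ge).2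

/-- The functional `f ↦ ‖|f| ^ (1 / r)‖ ^ r` on `X^r`. -/
noncomputable def powNrm (X : QuasiKothe μ) (r : ℝ) (f : Ω →ₘ[μ] ℝ) : ℝ :=
  X.nrm (absPow (1 / r) f) ^ r

variable (X : QuasiKothe μ) {r : ℝ} (hr : 0 < r)

theorem power_isSolid : IsSolid (X.power r hr) := fun f g hg h => by
  refine (X.ideal (absPow (1 / r) f) (absPow (1 / r) g) hg ?_).1
  rw [abs_of_nonneg (absPow_nonneg _ _), abs_of_nonneg (absPow_nonneg _ _)]
  exact absPow_le_absPow (by positivity) h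

theorem powNrm_nonneg {f : Ω →ₘ[μ] ℝ} (hf : f ∈ X.power r hr) : 0 ≤ X.powNrm r f :=
  Real.rpow_nonneg (X.nrm_nonneg _ hf) r

theorem powNrm_mono {f g : Ω →ₘ[μ] ℝ} (hg : g ∈ X.power r hr)
    (h : ∀ᵐ a ∂μ, |f a| ≤ |g a|) : X.powNrm r f ≤ X.powNrm r g := by
  have h1 := X.ideal (absPow (1 / r) f) (absPow (1 / r) g) hg (by
    rw [abs_of_nonneg (absPow_nonneg _ _), abs_of_nonneg (absPow_nonneg _ _)]
    exact absPow_le_absPow (by positivity) h)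
  exact Real.rpow_le_rpow (X.nrm_nonneg _ h1.1) h1.2 hr.le

theorem powNrm_mono_of_le {f g : Ω →ₘ[μ] ℝ} (hg : g ∈ X.power r hr) (h0 : 0 ≤ f)
    (h : f ≤ g) : X.powNrm r f ≤ X.powNrm r g := by
  refine X.powNrm_mono hr hg (abs_le_abs_iff_ae.1 ?_)
  rwa [abs_of_nonneg h0, abs_of_nonneg (h0.trans h)]

theorem powNrm_smul {f : Ω →ₘ[μ] ℝ} (hf : f ∈ X.power r hr) {c : ℝ} (hc : 0 ≤ c) :
    X.powNrm r (c • f) = c * X.powNrm r f := by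
  rw [powNrm, absPow_smul, X.nrm_smul _ _ hf, abs_of_nonneg hc,
    abs_of_nonneg (by positivity : 0 ≤ c ^ (1 / r)),
    Real.mul_rpow (by positivity) (X.nrm_nonneg _ hf), ← Real.rpow_mul hc,
    one_div_mul_cancel hr.ne', Real.rpow_one, powNrm]

theorem powNrm_absPow (hr : 0 < r) {x : Ω →ₘ[μ] ℝ} (hx : x ∈ X.carrier) :
    X.powNrm r (absPow r x) = X.nrm x ^ r := by
  rw [powNrm, absPow_absPow (mul_one_div_cancel hr.ne'), X.nrm_abs hx]

theorem lrSum_absPow (hr : 0 < r) {n : ℕ} (f : Fin n → Ω →ₘ[μ] ℝ) (h0 : ∀ k, 0 ≤ f k) :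
    lrSum r (fun k => absPow (1 / r) (f k)) = absPow (1 / r) (∑ k, f k) := by
  rw [lrSum]
  congr 1
  refine Finset.sum_congr rfl fun k _ => ?_
  rw [absPow_absPow (one_div_mul_cancel hr.ne'), abs_of_nonneg (h0 k)]

/-- The r-th power of the r-convexity inequality for fₖ^(1/r): on the positive cone, convexity
becomes subadditivity up to a constant. -/
theorem ConvexConst.powNrm_sum_le {X : QuasiKothe μ} {c : ℝ} (hc : X.ConvexConst r c) {n : ℕ}
    {f : Fin n → Ω →ₘ[μ] ℝ} (hf : ∀ k, f k ∈ X.power r hr) (h0 : ∀ k, 0 ≤ f k) :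
    X.powNrm r (∑ k, f k) ≤ c ^ r * ∑ k, X.powNrm r (f k) := by
  have h1 := hc.2 n (fun k => absPow (1 / r) (f k)) hf
  rw [lrSum_absPow hr f h0] at h1
  have hs : 0 ≤ ∑ k, X.nrm (absPow (1 / r) (f k)) ^ r := Finset.sum_nonneg fun k _ => X.powNrm_nonneg hr (hf k)
  have h2 := Real.rpow_le_rpow
    (X.nrm_nonneg _ ((X.power r hr).sum_mem fun k _ => hf k)) h1 hr.le
  rwa [Real.mul_rpow hc.1 (Real.rpow_nonneg hs _), ← Real.rpow_mul hs,
    one_div_mul_cancel hr.ne', Real.rpow_one] at h2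

theorem ConcaveConst.sum_powNrm_le {X : QuasiKothe μ} {c : ℝ} (hc : X.ConcaveConst r c) {n : ℕ}
    {f : Fin n → Ω →ₘ[μ] ℝ} (hf : ∀ k, f k ∈ X.power r hr) (h0 : ∀ k, 0 ≤ f k) :
    ∑ k, X.powNrm r (f k) ≤ c ^ r * X.powNrm r (∑ k, f k) := by
  have h1 := hc.2 n (fun k => absPow (1 / r) (f k)) hf
  rw [lrSum_absPow hr f h0] at h1
  have hs : 0 ≤ ∑ k, X.nrm (absPow (1 / r) (f k)) ^ r := Finset.sum_nonneg fun k _ => X.powNrm_nonneg hr (hf k)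
  have h2 := Real.rpow_le_rpow (Real.rpow_nonneg hs _) h1 hr.le
  rwa [Real.mul_rpow hc.1 (X.nrm_nonneg _ ((X.power r hr).sum_mem fun k _ => hf k)),
    ← Real.rpow_mul hs, one_div_mul_cancel hr.ne', Real.rpow_one] at h2

/-- The infimum is attained: each instance with a positive right-hand sum is a lower bound on c, and
an instance with zero sum is settled by any admissible constant. -/
theorem IsRConvex.convexConst {X : QuasiKothe μ} (hX : X.IsRConvex r) :
    X.ConvexConst r (X.convexityConst r) := by
  refine ⟨le_csInf hX fun c hc => hc.1, fun n x hx => ?_⟩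
  have hs : 0 ≤ (∑ k, X.nrm (x k) ^ r) ^ (1 / r) := Real.rpow_nonneg
    (Finset.sum_nonneg fun k _ => Real.rpow_nonneg (X.nrm_nonneg _ (hx k)) _) _
  rcases hs.eq_or_lt with h | h
  · obtain ⟨c, hc⟩ := hX
    have := hc.2 n x hx
    rwa [← h, mul_zero] at this ⊢
  · rw [← div_le_iff₀ h]
    exact le_csInf hX fun c hc => (div_le_iff₀ h).2 (hc.2 n x hx)

theorem IsRConcave.concaveConst {X : QuasiKothe μ} (hr : 0 < r) (hX : X.IsRConcave r) :
    X.ConcaveConst r (X.concavityConst r) := by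
  refine ⟨le_csInf hX fun c hc => hc.1, fun n x hx => ?_⟩
  have hs : 0 ≤ X.nrm (lrSum r x) := X.nrm_nonneg _ (X.lrSum_mem r hr x hx)
  rcases hs.eq_or_lt with h | h
  · obtain ⟨c, hc⟩ := hX
    have := hc.2 n x hx
    rwa [← h, mul_zero] at this ⊢
  · rw [← div_le_iff₀ h]
    exact le_csInf hX fun c hc => (div_le_iff₀ h).2 (hc.2 n x hx)

end QuasiKothe

end

/-! ### Solid hulls and the separation of p from q. -/

open MeasureTheory.AEEqFun

/-- The solid hull of the convex cone that the classes `b x` generate. -/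
def solidHull {Ω U : Type*} [MeasurableSpace Ω] {ν : Measure Ω} (b : U → Ω →ₘ[ν] ℝ)
    (hb : ∀ c : ℝ, 0 < c → ∀ x, ∃ x', b x' = c • b x) : Submodule ℝ (Ω →ₘ[ν] ℝ) where
  carrier := {g | ∃ h ∈ AddSubmonoid.closure (Set.range b), |g| ≤ h}
  zero_mem' := ⟨0, zero_mem _, by simp⟩
  add_mem' := by
    rintro f g ⟨h₁, hm₁, h₁'⟩ ⟨h₂, hm₂, h₂'⟩
    exact ⟨h₁ + h₂, add_mem hm₁ hm₂, (abs_add_le f g).trans (add_le_add h₁' h₂')⟩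
  smul_mem' := by
    rintro c f ⟨h, hm, hh⟩
    by_cases hc : c = 0
    · exact ⟨0, zero_mem _, by simp [hc]⟩
    · refine ⟨|c| • h, AddSubmonoid.smul_mem_closure_range (hb _ (abs_pos.2 hc)) hm, ?_⟩
      refine le_trans (le_of_eq ?_) (smul_le_smul_of_nonneg_left_real (abs_nonneg c) hh)
      apply AEEqFun.ext
      filter_upwards [coeFn_abs (c • f), coeFn_smul c f, coeFn_smul |c| |f|, coeFn_abs f]
        with a h1 h2 h3 h4
      rw [h1, h2, h3, Pi.smul_apply, Pi.smul_apply, h4, smul_eq_mul, smul_eq_mul, abs_mul]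

theorem solidHull_isSolid {Ω U : Type*} [MeasurableSpace Ω] {ν : Measure Ω} (b : U → Ω →ₘ[ν] ℝ)
    (hb : ∀ c : ℝ, 0 < c → ∀ x, ∃ x', b x' = c • b x) : IsSolid (solidHull b hb) := by
  rintro f g ⟨h, hm, hh⟩ hfg
  exact ⟨h, hm, (abs_le_abs_iff_ae.2 hfg).trans hh⟩

theorem mem_solidHull {Ω U : Type*} [MeasurableSpace Ω] {ν : Measure Ω} (b : U → Ω →ₘ[ν] ℝ)
    (hb : ∀ c : ℝ, 0 < c → ∀ x, ∃ x', b x' = c • b x) (x : U) (h0 : 0 ≤ b x) :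
    b x ∈ solidHull b hb :=
  ⟨b x, AddSubmonoid.subset_closure ⟨x, rfl⟩, (abs_of_nonneg h0).le⟩

theorem solidHull_le {Ω U : Type*} [MeasurableSpace Ω] {ν : Measure Ω} (b : U → Ω →ₘ[ν] ℝ)
    (hb : ∀ c : ℝ, 0 < c → ∀ x, ∃ x', b x' = c • b x) {J : Submodule ℝ (Ω →ₘ[ν] ℝ)}
    (hJ : IsSolid J) (h : ∀ x, b x ∈ J) : solidHull b hb ≤ J := by
  rintro g ⟨k, hk, hgk⟩
  have hkJ : k ∈ J := by
    have : AddSubmonoid.closure (Set.range b) ≤ J.toAddSubmonoid :=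
      AddSubmonoid.closure_le.2 (Set.range_subset_iff.2 h)
    exact this hk
  exact hJ g k hkJ (abs_le_abs_iff_ae.1 (hgk.trans (le_abs_self k)))

namespace QuasiKothe

/-- The graph of `powNrm` on the positive cone of a linear space of classes. -/
noncomputable def powGraph {Ω : Type*} [MeasurableSpace Ω] {μ : Measure Ω} (X : QuasiKothe μ)
    (r : ℝ) (J : Submodule ℝ (Ω →ₘ[μ] ℝ)) (f : {f : Ω →ₘ[μ] ℝ // f ∈ J ∧ 0 ≤ f}) :
    (Ω →ₘ[μ] ℝ) × ℝ :=
  (f, X.powNrm r f)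

section

variable {Ω : Type*} [MeasurableSpace Ω] {μ : Measure Ω} (X : QuasiKothe μ) {r : ℝ} (hr : 0 < r)
  {J : Submodule ℝ (Ω →ₘ[μ] ℝ)}

theorem mem_closure_powGraph {f : Ω →ₘ[μ] ℝ} (hf : f ∈ J) (h0 : 0 ≤ f) :
    (f, X.powNrm r f) ∈ AddSubmonoid.closure (Set.range (X.powGraph r J)) :=
  AddSubmonoid.subset_closure ⟨⟨f, hf, h0⟩, rfl⟩

theorem exists_sum_of_mem_closure_powGraph {p : (Ω →ₘ[μ] ℝ) × ℝ}
    (hp : p ∈ AddSubmonoid.closure (Set.range (X.powGraph r J))) :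
    ∃ (n : ℕ) (f : Fin n → Ω →ₘ[μ] ℝ), (∀ k, f k ∈ J) ∧ (∀ k, 0 ≤ f k) ∧ p.1 = ∑ k, f k ∧
      p.2 = ∑ k, X.powNrm r (f k) := by
  obtain ⟨n, f, rfl⟩ := AddSubmonoid.exists_sum_of_mem_closure_range hp
  exact ⟨n, fun k => f k, fun k => (f k).2.1, fun k => (f k).2.2, by simp [powGraph, Prod.fst_sum],
    by simp [powGraph, Prod.snd_sum]⟩

theorem smul_mem_closure_powGraph (hJ : J ≤ X.power r hr) {c : ℝ} (hc : 0 < c)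
    {p : (Ω →ₘ[μ] ℝ) × ℝ} (hp : p ∈ AddSubmonoid.closure (Set.range (X.powGraph r J))) :
    c • p ∈ AddSubmonoid.closure (Set.range (X.powGraph r J)) := by
  refine AddSubmonoid.smul_mem_closure_range ?_ hp
  rintro ⟨f, hf, h0⟩
  refine ⟨⟨c • f, J.smul_mem c hf, ?_⟩, ?_⟩
  · simpa using smul_le_smul_of_nonneg_left_real hc.le h0
  · ext1
    · rfl
    · exact X.powNrm_smul hr (hJ hf) hc.le

end

/-- Separation of an `r`-convex from an `r`-concave functional along a family of pairs
`(a x, b x)`. -/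
theorem exists_separating_functionals {Ω₁ Ω₂ U : Type*} [MeasurableSpace Ω₁] [MeasurableSpace Ω₂]
    {μ : Measure Ω₁} {ν : Measure Ω₂} (X : QuasiKothe μ) (Y : QuasiKothe ν) {r : ℝ} (hr : 0 < r)
    {c₁ c₂ : ℝ} (hX : X.ConvexConst r c₁) (hY : Y.ConcaveConst r c₂)
    (a : U → Ω₁ →ₘ[μ] ℝ) (b : U → Ω₂ →ₘ[ν] ℝ) (ha : ∀ x, a x ∈ X.power r hr) (ha0 : ∀ x, 0 ≤ a x)
    (hb : ∀ x, b x ∈ Y.power r hr) (hb0 : ∀ x, 0 ≤ b x)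
    (hs : ∀ c : ℝ, 0 < c → ∀ x, ∃ x', a x' = c • a x ∧ b x' = c • b x)
    (hab : ∀ (n : ℕ) (x : Fin n → U), Y.powNrm r (∑ k, b (x k)) ≤ X.powNrm r (∑ k, a (x k))) :
    ∃ (I : Submodule ℝ (Ω₂ →ₘ[ν] ℝ)) (Λ₁ : (Ω₁ →ₘ[μ] ℝ) →ₗ[ℝ] ℝ) (Λ₂ : (Ω₂ →ₘ[ν] ℝ) →ₗ[ℝ] ℝ),
      IsSolid I ∧ I ≤ Y.power r hr ∧ (∀ x, b x ∈ I) ∧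
      PositiveOn (X.power r hr) Λ₁ ∧ PositiveOn I Λ₂ ∧
      (∀ f ∈ X.power r hr, 0 ≤ f → Λ₁ f ≤ c₁ ^ r * X.powNrm r f) ∧
      (∀ g ∈ I, 0 ≤ g → Y.powNrm r g ≤ c₂ ^ r * Λ₂ g) ∧ ∀ x, Λ₂ (b x) ≤ Λ₁ (a x) := by
  have hbs : ∀ c : ℝ, 0 < c → ∀ x, ∃ x', b x' = c • b x := fun c hc x =>
    (hs c hc x).imp fun _ h => h.2
  -- Λ₂ is built only on I: there every element is dominated by a sum of b(x), which is what
  -- supplies finite bounds.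
  set I := solidHull b hbs
  have hI : IsSolid I := solidHull_isSolid b hbs
  have hIY : I ≤ Y.power r hr := solidHull_le b hbs (Y.power_isSolid hr) hb
  have hbI : ∀ x, b x ∈ I := fun x => mem_solidHull b hbs x (hb0 x)
  have hc₁ : 0 ≤ c₁ ^ r := Real.rpow_nonneg hX.1 r
  have hc₂ : 0 ≤ c₂ ^ r := Real.rpow_nonneg hY.1 r
  set C := AddSubmonoid.closure (Set.range fun x => (a x, b x)) with hC
  set P := AddSubmonoid.closure (Set.range (X.powGraph r (X.power r hr))) with hP
  set Q := AddSubmonoid.closure (Set.range (Y.powGraph r I)) with hQ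
  -- The functional sought is L(f, g) = Λ₁ f - Λ₂ g. If f ≤ ∑ fᵢ - ∑ a(xⱼ) and g ≥ ∑ gᵢ - ∑ b(xⱼ)
  -- with fᵢ, gᵢ ≥ 0, the desired properties force L(f, g) ≤ c₁^r ∑ p(fᵢ) - ∑ q(gᵢ) / c₂^r; D
  -- collects these forced bounds.
  let D : X.power r hr × I → ℝ → Prop := fun v s => ∃ p ∈ P, ∃ q ∈ Q, ∃ c ∈ C,
    (v.1 : Ω₁ →ₘ[μ] ℝ) + c.1 ≤ p.1 ∧ q.1 ≤ (v.2 : Ω₂ →ₘ[ν] ℝ) + c.2 ∧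
      c₁ ^ r * p.2 - q.2 / c₂ ^ r ≤ s
  have hadd : ∀ v w s t, D v s → D w t → D (v + w) (s + t) := by
    rintro v w s t ⟨p, hp, q, hq, c, hc, h1, h2, h3⟩ ⟨p', hp', q', hq', c', hc', h1', h2', h3'⟩
    refine ⟨p + p', add_mem hp hp', q + q', add_mem hq hq', c + c', add_mem hc hc', ?_, ?_, ?_⟩
    · have := add_le_add h1 h1'
      rwa [add_add_add_comm] at this
    · have := add_le_add h2 h2'
      rwa [add_add_add_comm] at this
    · have := add_le_add h3 h3'
      rw [Prod.snd_add, Prod.snd_add, mul_add, add_div]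
      linarith
  have hsmul : ∀ c : ℝ, 0 < c → ∀ v s, D v s → D (c • v) (c * s) := by
    rintro k hk v s ⟨p, hp, q, hq, c, hc, h1, h2, h3⟩
    refine ⟨k • p, X.smul_mem_closure_powGraph hr le_rfl hk hp, k • q,
      Y.smul_mem_closure_powGraph hr hIY hk hq, k • c,
      AddSubmonoid.smul_mem_closure_range (fun x => ?_) hc, ?_, ?_, ?_⟩
    · obtain ⟨x', h, h'⟩ := hs k hk x
      exact ⟨x', Prod.ext h h'⟩
    · have := smul_le_smul_of_nonneg_left_real hk.le h1
      rwa [smul_add] at this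
    · have := smul_le_smul_of_nonneg_left_real hk.le h2
      rwa [smul_add] at this
    · have := mul_le_mul_of_nonneg_left h3 hk.le
      rw [Prod.smul_snd, Prod.smul_snd, smul_eq_mul, smul_eq_mul]
      refine le_trans (le_of_eq ?_) this
      ring
  have hCmem : ∀ c ∈ C, c.1 ∈ X.power r hr ∧ 0 ≤ c.1 ∧ c.2 ∈ I ∧ 0 ≤ c.2 ∧
      Y.powNrm r c.2 ≤ X.powNrm r c.1 := by
    intro c hc
    obtain ⟨n, x, rfl⟩ := AddSubmonoid.exists_sum_of_mem_closure_range hc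
    simp only [Prod.fst_sum, Prod.snd_sum]
    exact ⟨(X.power r hr).sum_mem fun k _ => ha _, Finset.sum_nonneg fun k _ => ha0 _,
      I.sum_mem fun k _ => hbI _, Finset.sum_nonneg fun k _ => hb0 _, hab n x⟩
  -- For |g| ≤ ∑ b(xₖ), take this sum for c, zero for q, and the single function |f| + ∑ a(xₖ) for
  -- p.
  have htot : ∀ v, ∃ s, D v s := by
    rintro ⟨⟨f, hf⟩, ⟨g, hg⟩⟩
    obtain ⟨h, hh, hgh⟩ := id hg
    obtain ⟨n, x, rfl⟩ := AddSubmonoid.exists_sum_of_mem_closure_range hh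
    have hcC : (∑ k, a (x k), ∑ k, b (x k)) ∈ C := by
      have : ∑ k, (a (x k), b (x k)) ∈ C :=
        sum_mem fun k _ => AddSubmonoid.subset_closure ⟨x k, rfl⟩
      convert this using 1
      ext1
      · simp [Prod.fst_sum]
      · simp [Prod.snd_sum]
    obtain ⟨h1, h2, -⟩ := hCmem _ hcC
    have hfabs : |f| ∈ X.power r hr := X.power_isSolid hr _ f hf
      (abs_le_abs_iff_ae.1 (abs_abs f).le)
    refine ⟨_, _, X.mem_closure_powGraph ((X.power r hr).add_mem hfabs h1)
      (add_nonneg (abs_nonneg f) h2), 0, zero_mem _, _, hcC, ?_, ?_, le_rfl⟩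
    · exact add_le_add_left (le_abs_self f) _
    · have h4 : -g ≤ ∑ k, b (x k) := (neg_le_abs g).trans hgh
      simpa using neg_le_iff_add_nonneg'.1 h4
  -- Concavity, monotonicity, the hypothesis `hab`, monotonicity and convexity chain to ∑ q(gᵢ) /
  -- c₂^r ≤ q(∑ gᵢ) ≤ q(∑ b) ≤ p(∑ a) ≤ p(∑ fᵢ) ≤ c₁^r ∑ p(fᵢ).
  have hpos : ∀ s, D 0 s → 0 ≤ s := by
    rintro s ⟨p, hp, q, hq, c, hc, h1, h2, h3⟩
    obtain ⟨n, f, hf, hf0, hp1, hp2⟩ := X.exists_sum_of_mem_closure_powGraph hp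
    obtain ⟨m, g, hg, hg0, hq1, hq2⟩ := Y.exists_sum_of_mem_closure_powGraph hq
    obtain ⟨k1, k2, k3, k4, k5⟩ := hCmem c hc
    have e1 : X.powNrm r p.1 ≤ c₁ ^ r * p.2 := by
      rw [hp1, hp2]
      exact hX.powNrm_sum_le hr hf hf0
    have e2 : q.2 / c₂ ^ r ≤ Y.powNrm r q.1 := by
      have hqI : q.1 ∈ Y.power r hr := hq1 ▸ (Y.power r hr).sum_mem fun k _ => hIY (hg k)
      refine div_le_of_le_mul₀ hc₂ (Y.powNrm_nonneg hr hqI) ?_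
      rw [hq1, hq2, mul_comm]
      exact hY.sum_powNrm_le hr (fun k => hIY (hg k)) hg0
    have e3 : X.powNrm r c.1 ≤ X.powNrm r p.1 := by
      refine X.powNrm_mono_of_le hr (hp1 ▸ (X.power r hr).sum_mem fun k _ => hf k) k2 ?_
      simpa using h1
    have e4 : Y.powNrm r q.1 ≤ Y.powNrm r c.2 := by
      refine Y.powNrm_mono_of_le hr (hIY k3) (hq1 ▸ Finset.sum_nonneg fun k _ => hg0 k) ?_
      simpa using h2
    linarith
  obtain ⟨L, hL⟩ := exists_linearMap_le_of_cone D hadd hsmul htot hpos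
  obtain ⟨Λ₁, hΛ₁⟩ := (L.comp (LinearMap.inl ℝ (X.power r hr) I)).exists_extend
  obtain ⟨Λ₂, hΛ₂⟩ := (-(L.comp (LinearMap.inr ℝ (X.power r hr) I))).exists_extend
  have e1 : ∀ f (hf : f ∈ X.power r hr), Λ₁ f = L (⟨f, hf⟩, 0) := fun f hf =>
    LinearMap.congr_fun hΛ₁ ⟨f, hf⟩
  have e2 : ∀ g (hg : g ∈ I), Λ₂ g = -L (0, ⟨g, hg⟩) := fun g hg =>
    LinearMap.congr_fun hΛ₂ ⟨g, hg⟩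
  have hlow : ∀ g ∈ I, 0 ≤ g → Y.powNrm r g / c₂ ^ r ≤ Λ₂ g := by
    intro g hg h0
    have := hL (0, ⟨g, hg⟩) (-(Y.powNrm r g / c₂ ^ r))
      ⟨0, zero_mem _, _, Y.mem_closure_powGraph hg h0, 0, zero_mem _, by simp, by simp, by simp⟩
    rw [e2 g hg]
    linarith
  -- The bounds in D used here have at most one nonzero entry among p, q, c: none for positivity of
  -- Λ₁, p for its upper bound, q for the lower bound of Λ₂, c for the comparison.
  refine ⟨I, Λ₁, Λ₂, hI, hIY, hbI, ?_, ?_, ?_, ?_, ?_⟩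
  · intro f hf h0
    have := hL (-(⟨f, hf⟩, 0)) 0
      ⟨0, zero_mem _, 0, zero_mem _, 0, zero_mem _, by simpa using h0, by simp, by simp⟩
    rw [map_neg] at this
    rw [e1 f hf]
    linarith
  · intro g hg h0
    exact (div_nonneg (Y.powNrm_nonneg hr (hIY hg)) hc₂).trans (hlow g hg h0)
  · intro f hf h0
    rw [e1 f hf]
    exact hL _ _ ⟨_, X.mem_closure_powGraph hf h0, 0, zero_mem _, 0, zero_mem _, by simp, by simp,
      by simp⟩
  · intro g hg h0
    -- If c₂^r = 0, the quotient in `hlow` is 0 by convention and carries no information; concavity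
    -- for a single function then gives q(g) ≤ 0 directly.
    rcases hc₂.eq_or_lt with h | h
    · have := hY.sum_powNrm_le hr (n := 1) (f := fun _ => g) (fun _ => hIY hg) fun _ => h0
      simp only [Finset.univ_unique, Finset.sum_singleton] at this
      rwa [← h, zero_mul] at this ⊢
    · rw [mul_comm, ← div_le_iff₀ h]
      exact hlow g hg h0
  · intro x
    have := hL (-(⟨a x, ha x⟩, ⟨b x, hbI x⟩)) 0
      ⟨0, zero_mem _, 0, zero_mem _, (a x, b x), AddSubmonoid.subset_closure ⟨x, rfl⟩, by simp,
        by simp, by simp⟩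
    have hsplit : ((⟨a x, ha x⟩, ⟨b x, hbI x⟩) : X.power r hr × I) =
        (⟨a x, ha x⟩, 0) + (0, ⟨b x, hbI x⟩) := by simp
    rw [map_neg, hsplit, map_add] at this
    rw [e1 _ (ha x), e2 _ (hbI x)]
    linarith

end QuasiKothe

/-! ### From functionals to weights: exhaustion, Fatou property, completeness. -/

section

variable {Ω : Type*} [MeasurableSpace Ω] {μ : Measure Ω}

/-- If the supports of `e n ∈ I` cover the support of `f`, then `f` is exhausted by members of the
solid space `I`. -/
theorem MeasureTheory.AEEqFun.IsSolid.exists_cut_mem {I : Submodule ℝ (Ω →ₘ[μ] ℝ)}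
    (hI : IsSolid I) {e : ℕ → Ω →ₘ[μ] ℝ} (he : ∀ n, e n ∈ I) (f : Ω →ₘ[μ] ℝ)
    (hf : ∀ᵐ a ∂μ, f a ≠ 0 → ∃ n, e n a ≠ 0) :
    ∃ A : ℕ → Set Ω, ∃ hA : ∀ n, MeasurableSet (A n), Monotone A ∧ (∀ᵐ a ∂μ, ∃ n, a ∈ A n) ∧
      ∀ n, cut (hA n) f ∈ I := by
  -- On the n-th set |f| ≤ n ∑ |e j| over j ≤ n, so solidity puts the cut-off into I.
  have hA : ∀ n : ℕ, MeasurableSet (⋃ j ∈ Finset.range (n + 1), {a | |f a| ≤ n * |e j a|}) :=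
    fun n => Finset.measurableSet_biUnion _ fun j _ =>
      measurableSet_le f.measurable.abs ((e j).measurable.abs.const_mul _)
  refine ⟨_, hA, ?_, ?_, ?_⟩
  · intro m n hmn a ha
    obtain ⟨j, hj, haj⟩ := Set.mem_iUnion₂.1 ha
    refine Set.mem_biUnion (Finset.range_mono (Nat.succ_le_succ hmn) hj)
      (show |f a| ≤ n * |e j a| from le_trans haj ?_)
    gcongr
  · filter_upwards [hf] with a h
    by_cases hfa : f a = 0
    · exact ⟨0, Set.mem_biUnion (Finset.mem_range.2 Nat.one_pos) (by simp [hfa])⟩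
    · obtain ⟨j, hj⟩ := h hfa
      obtain ⟨N, hN⟩ := exists_nat_ge (|f a| / |e j a|)
      refine ⟨max j N, Set.mem_biUnion (Finset.mem_range.2 (by lia : j < max j N + 1)) ?_⟩
      have := (div_le_iff₀ (abs_pos.2 hj)).1 hN
      refine this.trans (mul_le_mul_of_nonneg_right ?_ (abs_nonneg _))
      exact_mod_cast le_max_right j N
  · intro n
    have habs : ∀ j, |e j| ∈ I := fun j =>
      hI _ _ (he j) (abs_le_abs_iff_ae.1 (abs_abs (e j)).le)
    have hmem : (n : ℝ) • ∑ j ∈ Finset.range (n + 1), |e j| ∈ I :=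
      I.smul_mem _ (I.sum_mem fun j _ => habs j)
    refine hI _ _ hmem ?_
    have h' : ∀ᵐ a ∂μ, ∀ j, |e j| a = |e j a| := ae_all_iff.2 fun j => coeFn_abs (e j)
    filter_upwards [coeFn_cut (hA n) f, h', coeFn_smul (n : ℝ) (∑ j ∈ Finset.range (n + 1), |e j|),
      coeFn_fun_finsetSum (Finset.range (n + 1)) fun j => |e j|] with a h1 h2 h3 h4
    rw [h1, h3, Pi.smul_apply, h4, smul_eq_mul]
    by_cases ha : a ∈ ⋃ j ∈ Finset.range (n + 1), {a | |f a| ≤ n * |e j a|}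
    · rw [Set.indicator_of_mem ha]
      obtain ⟨j, hj, haj⟩ := Set.mem_iUnion₂.1 ha
      refine le_trans (le_trans haj ?_) (le_abs_self _)
      gcongr
      rw [← h2 j]
      exact Finset.single_le_sum (f := fun j => |e j| a)
        (fun i _ => by rw [h2]; exact abs_nonneg _) hj
    · rw [Set.indicator_of_notMem ha, abs_zero]
      exact abs_nonneg _

theorem eLpNorm_ofReal_eq_lintegral {r : ℝ} (hr : 0 < r) (f : Ω → ℝ) :
    eLpNorm f (ENNReal.ofReal r) μ = (∫⁻ a, ENNReal.ofReal (|f a| ^ r) ∂μ) ^ (1 / r) := by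
  rw [eLpNorm_eq_lintegral_rpow_enorm_toReal (ENNReal.ofReal_pos.2 hr).ne' ENNReal.ofReal_ne_top,
    ENNReal.toReal_ofReal hr.le]
  congr 1
  refine lintegral_congr fun a => ?_
  rw [Real.enorm_eq_ofReal_abs, ENNReal.ofReal_rpow_of_nonneg (abs_nonneg _) hr.le]

namespace QuasiKothe

variable (X : QuasiKothe μ) {r : ℝ} (hr : 0 < r)

theorem powNrm_eq_zero_iff {f : Ω →ₘ[μ] ℝ} (hf : f ∈ X.power r hr) :
    X.powNrm r f = 0 ↔ ∀ᵐ a ∂μ, f a = 0 := by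
  rw [powNrm, Real.rpow_eq_zero (X.nrm_nonneg _ hf) hr.ne', X.nrm_eq_zero_iff _ hf]
  constructor
  · intro h
    filter_upwards [coeFn_absPow (1 / r) f, coeFn_zero (μ := μ) (β := ℝ) (α := Ω)] with a h1 h2
    rw [h, h2] at h1
    have h1 : 0 = |f a| ^ (1 / r) := h1
    exact abs_eq_zero.1 ((Real.rpow_eq_zero (abs_nonneg _) (by positivity)).1 h1.symm)
  · intro h
    apply AEEqFun.ext
    filter_upwards [coeFn_absPow (1 / r) f, coeFn_zero (μ := μ) (β := ℝ) (α := Ω), h]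
      with a h1 h2 h3
    rw [h1, h2, h3, abs_zero, Real.zero_rpow (by positivity)]
    rfl

theorem tendsto_powNrm_cut {f : Ω →ₘ[μ] ℝ} (hf : f ∈ X.power r hr) {A : ℕ → Set Ω}
    (hA : ∀ n, MeasurableSet (A n)) (hmono : Monotone A)
    (hcov : ∀ᵐ a ∂μ, ∃ n, a ∈ A n) :
    Tendsto (fun n => X.powNrm r (cut (hA n) f)) atTop (𝓝 (X.powNrm r f)) := by
  have key := X.fatou (fun n => absPow (1 / r) (cut (hA n) f)) (absPow (1 / r) f)
    (fun n => (X.power_isSolid hr).cut_mem hf (hA n)) hf (fun n => absPow_nonneg _ _) ?_ ?_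
  · exact key.rpow_const (Or.inr hr.le)
  · intro m n hmn
    refine absPow_le_absPow (by positivity) ?_
    filter_upwards [coeFn_cut (hA m) f, coeFn_cut (hA n) f] with a h1 h2
    rw [h1, h2]
    by_cases ha : a ∈ A m
    · simp [ha, hmono hmn ha]
    · simp [ha]
  · have h' : ∀ᵐ a ∂μ, ∀ n, absPow (1 / r) (cut (hA n) f) a = |(A n).indicator f a| ^ (1 / r) :=
      ae_all_iff.2 fun n => by
        filter_upwards [coeFn_absPow (1 / r) (cut (hA n) f), coeFn_cut (hA n) f] with a h1 h2
        rw [h1, h2]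
    filter_upwards [h', hcov, coeFn_absPow (1 / r) f] with a h1 ⟨N, hN⟩ h3
    refine tendsto_const_nhds.congr' ?_
    filter_upwards [eventually_ge_atTop N] with n hn
    rw [h1, h3, Set.indicator_of_mem (hmono hn hN)]

/-- A lower bound for a positive functional passes to its countably additive part. -/
theorem powNrm_le_outer {I : Submodule ℝ (Ω →ₘ[μ] ℝ)} {Λ : (Ω →ₘ[μ] ℝ) →ₗ[ℝ] ℝ}
    (hI : IsSolid I) (hIX : I ≤ X.power r hr) (hΛ : PositiveOn I Λ) {K : ℝ} (hK : 0 ≤ K)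
    (hlow : ∀ g ∈ I, 0 ≤ g → X.powNrm r g ≤ K * Λ g) {f : Ω →ₘ[μ] ℝ} (hf : f ∈ I) (h0 : 0 ≤ f) :
    X.powNrm r f ≤ K * (outer Λ f Set.univ).toReal := by
  have hε : ∀ ε : ℝ, 0 < ε → X.powNrm r f ≤ K * ((outer Λ f Set.univ).toReal + ε) := by
    intro ε hε
    -- Along these cut-offs Λ exceeds the countably additive mass by at most ε, while `powNrm`
    -- converges to its value at f.
    obtain ⟨A, hA, hmono, hcov, hle⟩ := exists_monotone_le hI hΛ hf h0 hε
    refine le_of_tendsto' (X.tendsto_powNrm_cut hr (hIX hf) hA hmono ?_) fun n =>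
      (hlow _ (hI.cut_mem hf _) (cut_nonneg h0 _)).trans (mul_le_mul_of_nonneg_left (hle n) hK)
    exact Eventually.of_forall fun a => Set.mem_iUnion.1 (hcov ▸ Set.mem_univ a)
  have hlim : Tendsto (fun n : ℕ => K * ((outer Λ f Set.univ).toReal + 1 / ((n : ℝ) + 1))) atTop
      (𝓝 (K * ((outer Λ f Set.univ).toReal + 0))) :=
    (tendsto_const_nhds.add tendsto_one_div_add_atTop_nhds_zero_nat).const_mul K
  rw [add_zero] at hlim
  exact ge_of_tendsto' hlim fun n => hε _ (by positivity)

/-- A positive functional on a solid part `I` of `X^r` that dominates a multiple of the functional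
`powNrm` can be replaced by a weight. -/
theorem exists_weight_of_powNrm_le [SigmaFinite μ] {I : Submodule ℝ (Ω →ₘ[μ] ℝ)}
    {Λ : (Ω →ₘ[μ] ℝ) →ₗ[ℝ] ℝ} (hI : IsSolid I) (hIX : I ≤ X.power r hr) (hΛ : PositiveOn I Λ)
    {K : ℝ} (hK : 0 ≤ K) (hlow : ∀ g ∈ I, 0 ≤ g → X.powNrm r g ≤ K * Λ g) :
    ∃ ρ : Ω → ℝ≥0∞, Measurable ρ ∧
      (∀ f ∈ I, 0 ≤ f → (∀ᵐ a ∂μ, f a ≠ 0 → ρ a ≠ 0 ∧ ρ a ≠ ∞) ∧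
        ∫⁻ a, ρ a * ENNReal.ofReal (f a) ∂μ ≤ ENNReal.ofReal (Λ f)) ∧
      (∀ f ∈ X.power r hr, 0 ≤ f → (∀ᵐ a ∂μ, f a ≠ 0 → ρ a ≠ 0) →
        ENNReal.ofReal (X.powNrm r f) ≤
          ENNReal.ofReal K * ∫⁻ a, ρ a * ENNReal.ofReal (f a) ∂μ) ∧
      ∀ f : Ω →ₘ[μ] ℝ, (∀ᵐ a ∂μ, f a ≠ 0 → ρ a ≠ 0) →
        ∃ A : ℕ → Set Ω, ∃ hA : ∀ n, MeasurableSet (A n), Monotone A ∧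
          (∀ᵐ a ∂μ, ∃ n, a ∈ A n) ∧ ∀ n, cut (hA n) f ∈ X.power r hr := by
  obtain ⟨ρ, e, hρ, heI, hρe, hρI⟩ := exists_weight hI hΛ
  have houter : ∀ f ∈ I, 0 ≤ f → ∫⁻ a, ρ a * ENNReal.ofReal (f a) ∂μ = outer Λ f Set.univ :=
    fun f hf h0 => by rw [← (hρI f hf h0).2 _ .univ, Measure.restrict_univ]
  have hexh : ∀ f : Ω →ₘ[μ] ℝ, (∀ᵐ a ∂μ, f a ≠ 0 → ρ a ≠ 0) →
      ∃ A : ℕ → Set Ω, ∃ hA : ∀ n, MeasurableSet (A n), Monotone A ∧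
        (∀ᵐ a ∂μ, ∃ n, a ∈ A n) ∧ ∀ n, cut (hA n) f ∈ I := fun f hf =>
    hI.exists_cut_mem heI f (by filter_upwards [hf, hρe] with a h1 h2 h3 using h2 (h1 h3))
  have hbase : ∀ f ∈ I, 0 ≤ f → ENNReal.ofReal (X.powNrm r f) ≤
      ENNReal.ofReal K * ∫⁻ a, ρ a * ENNReal.ofReal (f a) ∂μ := fun f hf h0 => by
    have hfin : outer Λ f Set.univ ≠ ∞ :=
      ((outer_univ_le f).trans_lt ENNReal.ofReal_lt_top).ne
    rw [houter f hf h0, ← ENNReal.ofReal_toReal hfin, ← ENNReal.ofReal_mul hK]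
    exact ENNReal.ofReal_le_ofReal (X.powNrm_le_outer hr hI hIX hΛ hK hlow hf h0)
  refine ⟨ρ, hρ, fun f hf h0 => ⟨?_, ?_⟩, fun f hf h0 hsupp => ?_, fun f hf => ?_⟩
  -- On {ρ = 0} the weighted integral vanishes, so `hbase` gives `powNrm` zero to the cut-off of f,
  -- and f vanishes there almost everywhere.
  · have hB : MeasurableSet {a | ρ a = 0} := hρ (measurableSet_singleton 0)
    have hg := hI.cut_mem hf hB
    have hzero : X.powNrm r (cut hB f) = 0 := by
      refine le_antisymm (ENNReal.ofReal_eq_zero.1 ?_) (X.powNrm_nonneg hr (hIX hg))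
      refine le_antisymm ((hbase _ hg (cut_nonneg h0 hB)).trans ?_) bot_le
      have : ∫⁻ a, ρ a * ENNReal.ofReal (cut hB f a) ∂μ = 0 := by
        rw [lintegral_congr_ae (g := fun _ => 0), lintegral_zero]
        filter_upwards [coeFn_cut hB f] with a h
        rw [h]
        by_cases ha : ρ a = 0 <;> simp [ha]
      rw [this, mul_zero]
    filter_upwards [(X.powNrm_eq_zero_iff hr (hIX hg)).1 hzero, coeFn_cut hB f,
      (hρI f hf h0).1] with a h1 h2 h3 h4
    refine ⟨fun h5 => h4 ?_, h3 h4⟩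
    rw [h2, Set.indicator_of_mem (show a ∈ {a | ρ a = 0} from h5)] at h1
    exact h1
  · rw [houter f hf h0]
    exact outer_univ_le f
  -- The bound extends from I to every member of the power space supported in {ρ ≠ 0}, since
  -- cut-offs in I exhaust it.
  · obtain ⟨A, hA, hmono, hcov, hmem⟩ := hexh f hsupp
    refine le_of_tendsto' (ENNReal.tendsto_ofReal (X.tendsto_powNrm_cut hr hf hA hmono hcov))
      fun n => (hbase _ (hmem n) (cut_nonneg h0 _)).trans ?_
    gcongr 1
    refine lintegral_mono_ae ?_
    filter_upwards [coeFn_cut (hA n) f, nonneg_iff.1 h0] with a h1 h2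
    rw [h1]
    gcongr
    exact Set.indicator_le_self' (fun _ _ => h2) a
  · obtain ⟨A, hA, hmono, hcov, hmem⟩ := hexh f hf
    exact ⟨A, hA, hmono, hcov, fun n => hIX (hmem n)⟩

/-- Under `σ`-order continuity, a bounded positive functional on `X^r` is given by a weight. -/
theorem SigmaOrderContinuous.exists_weight [SigmaFinite μ] {X : QuasiKothe μ}
    (hX : X.SigmaOrderContinuous) {Λ : (Ω →ₘ[μ] ℝ) →ₗ[ℝ] ℝ} (hΛ : PositiveOn (X.power r hr) Λ)
    {K : ℝ} (hup : ∀ f ∈ X.power r hr, 0 ≤ f → Λ f ≤ K * X.powNrm r f) :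
    ∃ ρ : Ω → ℝ≥0∞, Measurable ρ ∧ ∀ f ∈ X.power r hr, 0 ≤ f →
      (∀ᵐ a ∂μ, f a ≠ 0 → ρ a ≠ ∞) ∧
        ∫⁻ a, ρ a * ENNReal.ofReal (f a) ∂μ = ENNReal.ofReal (Λ f) := by
  have hI := X.power_isSolid hr
  obtain ⟨ρ, e, hρ, heI, hρe, hρI⟩ := AEEqFun.exists_weight hI hΛ
  refine ⟨ρ, hρ, fun f hf h0 => ⟨(hρI f hf h0).1, ?_⟩⟩
  have hfin : outer Λ f Set.univ ≠ ∞ := ((outer_univ_le f).trans_lt ENNReal.ofReal_lt_top).ne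
  have h1 := (hρI f hf h0).2 _ .univ
  rw [Measure.restrict_univ] at h1
  rw [h1]
  refine le_antisymm (outer_univ_le f) ?_
  rw [← ENNReal.ofReal_toReal hfin]
  refine ENNReal.ofReal_le_ofReal (le_of_forall_pos_le_add fun ε hε => ?_)
  obtain ⟨A, hA, hmono, hcov, hle⟩ := exists_monotone_le hI hΛ hf h0 hε
  -- The remainders f · 1 outside A n decrease to 0, so σ-order continuity and `hup` make their
  -- contribution to Λ f negligible.
  have hlim : Tendsto (fun n => X.nrm (absPow (1 / r) (cut (hA n).compl f))) atTop (𝓝 0) := by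
    refine hX _ (fun n => hI.cut_mem hf _) (fun n => absPow_nonneg _ _) ?_ ?_
    · intro m n hmn
      refine absPow_le_absPow (by positivity) ?_
      filter_upwards [coeFn_cut (hA m).compl f, coeFn_cut (hA n).compl f] with a h1 h2
      rw [h1, h2]
      by_cases ha : a ∈ A m
      · simp [ha, hmono hmn ha]
      · by_cases hb : a ∈ A n <;> simp [ha, hb]
    · have h' : ∀ᵐ a ∂μ, ∀ n, absPow (1 / r) (cut (hA n).compl f) a =
          |(A n)ᶜ.indicator f a| ^ (1 / r) :=
        ae_all_iff.2 fun n => by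
          filter_upwards [coeFn_absPow (1 / r) (cut (hA n).compl f), coeFn_cut (hA n).compl f]
            with a h1 h2
          rw [h1, h2]
      filter_upwards [h'] with a h1
      obtain ⟨N, hN⟩ := Set.mem_iUnion.1 (hcov ▸ Set.mem_univ a)
      refine tendsto_const_nhds.congr' ?_
      filter_upwards [eventually_ge_atTop N] with n hn
      rw [h1, Set.indicator_of_notMem (Set.notMem_compl_iff.2 (hmono hn hN)), abs_zero,
        Real.zero_rpow (by positivity)]
  have hlim2 : Tendsto (fun n => K * X.powNrm r (cut (hA n).compl f) +
      ((outer Λ f Set.univ).toReal + ε)) atTop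
        (𝓝 (K * (0 : ℝ) ^ r + ((outer Λ f Set.univ).toReal + ε))) :=
    ((hlim.rpow_const (Or.inr hr.le)).const_mul K).add_const _
  rw [Real.zero_rpow hr.ne', mul_zero, zero_add] at hlim2
  refine ge_of_tendsto' hlim2 fun n => ?_
  have hsplit : f = cut (hA n).compl f + cut (hA n) f := by
    apply AEEqFun.ext
    filter_upwards [coeFn_add (cut (hA n).compl f) (cut (hA n) f), coeFn_cut (hA n) f,
      coeFn_cut (hA n).compl f] with a h1 h2 h3
    rw [h1, Pi.add_apply, h2, h3]
    by_cases ha : a ∈ A n <;> simp [ha]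
  calc Λ f = Λ (cut (hA n).compl f) + Λ (cut (hA n) f) := by rw [← map_add, ← hsplit]
    _ ≤ _ := add_le_add (hup _ (hI.cut_mem hf _) (cut_nonneg h0 _)) (hle n)

/-- A class is a member of a complete space if it is exhausted by a Cauchy sequence of cut-offs. -/
theorem Complete.mem_of_cut {X : QuasiKothe μ} (hX : X.Complete) (z : Ω →ₘ[μ] ℝ) {A : ℕ → Set Ω}
    (hA : ∀ n, MeasurableSet (A n)) (hmono : Monotone A) (hcov : ∀ᵐ a ∂μ, ∃ n, a ∈ A n)
    (hmem : ∀ n, cut (hA n) |z| ∈ X.carrier)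
    (hcau : ∀ ε > 0, ∃ N, ∀ m ≥ N, ∀ n ≥ m,
      X.nrm (cut ((hA n).diff (hA m)) |z|) < ε) : z ∈ X.carrier := by
  have hdiff : ∀ m n, m ≤ n → cut (hA n) |z| - cut (hA m) |z| = cut ((hA n).diff (hA m)) |z| := by
    intro m n hmn
    apply AEEqFun.ext
    filter_upwards [coeFn_sub (cut (hA n) |z|) (cut (hA m) |z|), coeFn_cut (hA n) |z|,
      coeFn_cut (hA m) |z|, coeFn_cut ((hA n).diff (hA m)) |z|] with a h1 h2 h3 h4
    rw [h1, Pi.sub_apply, h2, h3, h4]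
    by_cases ha : a ∈ A m
    · simp [ha, hmono hmn ha]
    · by_cases hb : a ∈ A n <;> simp [ha, hb]
  have hneg : ∀ x ∈ X.carrier, X.nrm (-x) = X.nrm x := fun x hx => by
    have := X.nrm_smul (-1) x hx
    simpa using this
  obtain ⟨y, hy, hlim⟩ := hX (fun n => cut (hA n) |z|) hmem (fun ε hε => by
    obtain ⟨N, hN⟩ := hcau ε hε
    refine ⟨N, fun m hm n hn => ?_⟩
    rcases le_total m n with h | h
    · rw [← neg_sub, hneg _ (X.carrier.sub_mem (hmem n) (hmem m)), hdiff m n h]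
      exact hN m hm n h
    · rw [hdiff n m h]
      exact hN n hn m h)
  -- The positive part of cut n - y is dominated by |cut m - y| for all m ≥ n, whose norms tend to
  -- 0. Hence the limit y dominates every cut-off, and so |z|.
  have hle : ∀ n, cut (hA n) |z| ≤ y := by
    intro n
    have hpos : (cut (hA n) |z| - y)⁺ ∈ X.carrier ∧
        ∀ m ≥ n, X.nrm (cut (hA n) |z| - y)⁺ ≤ X.nrm (cut (hA m) |z| - y) := by
      have hdom : ∀ m ≥ n, |(cut (hA n) |z| - y)⁺| ≤ |cut (hA m) |z| - y| := by
        intro m hm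
        rw [abs_of_nonneg (posPart_nonneg _)]
        refine sup_le ?_ (abs_nonneg _)
        refine le_trans (sub_le_sub_right ?_ y) (le_abs_self _)
        rw [← sub_nonneg, hdiff n m hm]
        exact cut_nonneg (abs_nonneg z) _
      exact ⟨(X.ideal _ _ (X.carrier.sub_mem (hmem n) hy) (hdom n le_rfl)).1, fun m hm =>
        (X.ideal _ _ (X.carrier.sub_mem (hmem m) hy) (hdom m hm)).2⟩
    have hz : X.nrm (cut (hA n) |z| - y)⁺ = 0 := by
      refine le_antisymm (ge_of_tendsto hlim ?_) (X.nrm_nonneg _ hpos.1)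
      filter_upwards [eventually_ge_atTop n] with m hm using hpos.2 m hm
    rw [X.nrm_eq_zero_iff _ hpos.1] at hz
    exact sub_nonpos.1 (posPart_eq_zero.1 hz)
  refine X.mem_of_ae_le hy ?_
  have h' : ∀ᵐ a ∂μ, ∀ n, (A n).indicator (fun a => |z a|) a ≤ y a := ae_all_iff.2 fun n => by
    filter_upwards [coeFn_le.2 (hle n), coeFn_cut (hA n) |z|, coeFn_abs z] with a h1 h2 h3
    rw [h2] at h1
    by_cases ha : a ∈ A n
    · simp only [ha, Set.indicator_of_mem] at h1 ⊢
      rwa [h3] at h1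
    · simpa [ha] using h1
  filter_upwards [h', hcov] with a h1 ⟨n, hn⟩
  have := h1 n
  rw [Set.indicator_of_mem hn] at this
  exact this.trans (le_abs_self _)

end QuasiKothe

end

/-! ### Multiplication by ω₂^(1/r) from L_r into Y. -/

section

variable {Ω : Type*} [MeasurableSpace Ω] {μ : Measure Ω} {r : ℝ}

theorem abs_absPow_mul_rpow (hr : 0 < r) (f g : Ω →ₘ[μ] ℝ) :
    ∀ᵐ a ∂μ, |(absPow (1 / r) f * g : Ω →ₘ[μ] ℝ) a| ^ r = |f a| * |g a| ^ r := by
  filter_upwards [coeFn_mul (absPow (1 / r) f) g, coeFn_absPow (1 / r) f] with a h1 h2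
  rw [h1, Pi.mul_apply, h2, abs_mul, abs_of_nonneg (by positivity : 0 ≤ |f a| ^ (1 / r)),
    Real.mul_rpow (by positivity) (abs_nonneg _), ← Real.rpow_mul (abs_nonneg _),
    one_div_mul_cancel hr.ne', Real.rpow_one]

theorem lintegral_rpow_le_one (hr : 0 < r) {y : Ω →ₘ[μ] ℝ}
    (hy : eLpNorm y (ENNReal.ofReal r) μ ≤ 1) : ∫⁻ a, ENNReal.ofReal (|y a| ^ r) ∂μ ≤ 1 := by
  rw [eLpNorm_ofReal_eq_lintegral hr] at hy
  have := ENNReal.rpow_le_rpow hy hr.le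
  rwa [← ENNReal.rpow_mul, one_div_mul_cancel hr.ne', ENNReal.rpow_one, ENNReal.one_rpow] at this

/-- If `ω = 1 / ρ`, then `ρ |ω ^ (1 / r) y| ^ r ≤ |y| ^ r`, and the support of `ω ^ (1 / r) y` is
contained in that of `ρ`. -/
theorem weight_mul_bound (hr : 0 < r) {ρ : Ω → ℝ≥0∞}
    (hω : AEStronglyMeasurable (fun a => ((ρ a)⁻¹).toReal) μ) (y : Ω →ₘ[μ] ℝ) :
    ∀ᵐ a ∂μ, ρ a * ENNReal.ofReal (|(absPow (1 / r) (AEEqFun.mk _ hω) * y : Ω →ₘ[μ] ℝ) a| ^ r) ≤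
      ENNReal.ofReal (|y a| ^ r) ∧
      ((absPow (1 / r) (AEEqFun.mk _ hω) * y : Ω →ₘ[μ] ℝ) a ≠ 0 → ρ a ≠ 0) := by
  filter_upwards [abs_absPow_mul_rpow hr (AEEqFun.mk _ hω) y, coeFn_mk _ hω] with a h1 h2
  rw [h2, abs_of_nonneg ENNReal.toReal_nonneg] at h1
  constructor
  · rw [h1, ENNReal.ofReal_mul ENNReal.toReal_nonneg, ← mul_assoc]
    refine mul_le_of_le_one_left bot_le ?_
    exact (mul_le_mul_right ENNReal.ofReal_toReal_le _).trans (ENNReal.mul_inv_le_one _)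
  · intro hz hρ
    rw [hρ, ENNReal.inv_zero, ENNReal.toReal_top, zero_mul,
      Real.rpow_eq_zero (abs_nonneg _) hr.ne', abs_eq_zero] at h1
    exact hz h1

namespace QuasiKothe

variable (Y : QuasiKothe μ) (hr : 0 < r) {M : ℝ} {ρ : Ω → ℝ≥0∞}

/-- A competitor w lives where ρ ≠ 0, so ‖w‖^r ≤ M^r ∫ ρ|w|^r ≤ M^r ∫ |y|^r. -/
theorem extNrm_weight_mul_le (hM : 0 ≤ M)
    (hρY : ∀ f ∈ Y.power r hr, 0 ≤ f → (∀ᵐ a ∂μ, f a ≠ 0 → ρ a ≠ 0) →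
      ENNReal.ofReal (Y.powNrm r f) ≤
        ENNReal.ofReal (M ^ r) * ∫⁻ a, ρ a * ENNReal.ofReal (f a) ∂μ)
    (hω : AEStronglyMeasurable (fun a => ((ρ a)⁻¹).toReal) μ) {y : Ω →ₘ[μ] ℝ}
    (hy : eLpNorm y (ENNReal.ofReal r) μ ≤ 1) :
    Y.extNrm (absPow (1 / r) (AEEqFun.mk _ hω) * y) ≤ ENNReal.ofReal M := by
  refine iSup₂_le fun w hw => ?_
  have hwz := abs_le_abs_iff_ae.1 hw.2
  have hbd := weight_mul_bound hr hω y
  have key := hρY (absPow r w) (Y.absPow_mem_power r hr hw.1) (absPow_nonneg _ _) (by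
    filter_upwards [hwz, hbd, coeFn_absPow r w] with a h1 h2 h3 h4
    refine h2.2 fun h5 => h4 ?_
    rw [h5, abs_zero] at h1
    rw [h3, le_antisymm h1 (abs_nonneg _), Real.zero_rpow hr.ne'])
  have hint : ∫⁻ a, ρ a * ENNReal.ofReal (absPow r w a) ∂μ ≤ 1 := by
    refine le_trans (lintegral_mono_ae ?_) (lintegral_rpow_le_one hr hy)
    filter_upwards [hwz, hbd, coeFn_absPow r w] with a h1 h2 h3
    refine le_trans ?_ h2.1
    rw [h3]
    gcongr
  rw [Y.powNrm_absPow hr hw.1] at key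
  have key2 : ENNReal.ofReal (Y.nrm w ^ r) ≤ ENNReal.ofReal (M ^ r) :=
    key.trans (mul_le_of_le_one_right bot_le hint)
  rw [ENNReal.ofReal_le_ofReal_iff (Real.rpow_nonneg hM r),
    Real.rpow_le_rpow_iff (Y.nrm_nonneg _ hw.1) hM hr] at key2
  exact ENNReal.ofReal_le_ofReal key2

/-- The cut-offs of |z| are Cauchy because their increments are controlled by the finite measure
|y|^r dμ of the shrinking complements; completeness then applies through `Complete.mem_of_cut`. -/
theorem weight_mul_mem
    (hρY : ∀ f ∈ Y.power r hr, 0 ≤ f → (∀ᵐ a ∂μ, f a ≠ 0 → ρ a ≠ 0) →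
      ENNReal.ofReal (Y.powNrm r f) ≤
        ENNReal.ofReal (M ^ r) * ∫⁻ a, ρ a * ENNReal.ofReal (f a) ∂μ)
    (hρex : ∀ f : Ω →ₘ[μ] ℝ, (∀ᵐ a ∂μ, f a ≠ 0 → ρ a ≠ 0) →
      ∃ A : ℕ → Set Ω, ∃ hA : ∀ n, MeasurableSet (A n), Monotone A ∧
        (∀ᵐ a ∂μ, ∃ n, a ∈ A n) ∧ ∀ n, cut (hA n) f ∈ Y.power r hr)
    (hω : AEStronglyMeasurable (fun a => ((ρ a)⁻¹).toReal) μ) {y : Ω →ₘ[μ] ℝ}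
    (hy : eLpNorm y (ENNReal.ofReal r) μ ≤ 1) (hY : Y.Complete) :
    absPow (1 / r) (AEEqFun.mk _ hω) * y ∈ Y.carrier := by
  have hbd := weight_mul_bound hr hω y
  set z : Ω →ₘ[μ] ℝ := absPow (1 / r) (AEEqFun.mk _ hω) * y with hz
  have hsupp : ∀ᵐ a ∂μ, absPow r z a ≠ 0 → ρ a ≠ 0 := by
    filter_upwards [hbd, coeFn_absPow r z] with a h1 h2 h3
    refine h1.2 fun h4 => h3 ?_
    rw [h2, h4, abs_zero, Real.zero_rpow hr.ne']
  obtain ⟨A, hA, hmono, hcov, hmem⟩ := hρex (absPow r z) hsupp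
  have hcut : ∀ {B : Set Ω} (hB : MeasurableSet B),
      absPow (1 / r) (cut hB (absPow r z)) = cut hB |z| := by
    intro B hB
    apply AEEqFun.ext
    filter_upwards [coeFn_absPow (1 / r) (cut hB (absPow r z)), coeFn_cut hB (absPow r z),
      coeFn_cut hB |z|, coeFn_absPow r z, coeFn_abs z] with a h1 h2 h3 h4 h5
    rw [h1, h2, h3]
    by_cases ha : a ∈ B
    · rw [Set.indicator_of_mem ha, Set.indicator_of_mem ha, h4, h5,
        abs_of_nonneg (by positivity : 0 ≤ |z a| ^ r), ← Real.rpow_mul (abs_nonneg _),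
        mul_one_div_cancel hr.ne', Real.rpow_one]
    · rw [Set.indicator_of_notMem ha, Set.indicator_of_notMem ha, abs_zero,
        Real.zero_rpow (by positivity)]
  refine hY.mem_of_cut z hA hmono hcov (fun n => hcut (hA n) ▸ hmem n) fun ε hε => ?_
  set κ : Measure Ω := μ.withDensity fun a => ENNReal.ofReal (|y a| ^ r) with hκ
  have hκfin : κ Set.univ ≤ 1 := by
    rw [hκ, withDensity_apply _ .univ, Measure.restrict_univ]
    exact lintegral_rpow_le_one hr hy
  have hlim : Tendsto (fun n => ENNReal.ofReal (M ^ r) * κ (A n)ᶜ) atTop (𝓝 0) := by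
    have h1 : Tendsto (fun n => κ (A n)ᶜ) atTop (𝓝 (κ (⋂ n, (A n)ᶜ))) :=
      tendsto_measure_iInter_atTop (fun n => (hA n).compl.nullMeasurableSet)
        (fun m n hmn => Set.compl_subset_compl.2 (hmono hmn))
        ⟨0, ((measure_mono (Set.subset_univ _)).trans_lt
          (hκfin.trans_lt ENNReal.one_lt_top)).ne⟩
    have h2 : κ (⋂ n, (A n)ᶜ) = 0 := by
      refine withDensity_absolutelyContinuous _ _ (measure_eq_zero_iff_ae_notMem.2 ?_)
      filter_upwards [hcov] with a ⟨n, hn⟩ h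
      exact Set.mem_iInter.1 h n hn
    rw [h2] at h1
    simpa using ENNReal.Tendsto.const_mul h1 (Or.inr ENNReal.ofReal_ne_top)
  obtain ⟨N, hN⟩ := eventually_atTop.1 (hlim.eventually_lt_const
    (ENNReal.ofReal_pos.2 (Real.rpow_pos_of_pos hε r)))
  refine ⟨N, fun m hm n hn => ?_⟩
  set B : Set Ω := A n \ A m
  have hB : MeasurableSet B := (hA n).diff (hA m)
  have hBmem : cut hB (absPow r z) ∈ Y.power r hr := by
    refine Y.power_isSolid hr _ _ (hmem n) ?_
    filter_upwards [coeFn_cut hB (absPow r z), coeFn_cut (hA n) (absPow r z)] with a h1 h2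
    rw [h1, h2]
    by_cases ha : a ∈ B
    · rw [Set.indicator_of_mem ha, Set.indicator_of_mem ha.1]
    · simp [ha]
  have hcarr : cut hB |z| ∈ Y.carrier := hcut hB ▸ hBmem
  have key := hρY _ hBmem (cut_nonneg (absPow_nonneg _ _) hB) (by
    filter_upwards [hsupp, coeFn_cut hB (absPow r z)] with a h1 h2 h3
    refine h1 fun h4 => h3 ?_
    rw [h2]
    by_cases ha : a ∈ B <;> simp [ha, h4])
  have hint : ∫⁻ a, ρ a * ENNReal.ofReal (cut hB (absPow r z) a) ∂μ ≤ κ (A m)ᶜ := by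
    rw [hκ, withDensity_apply _ (hA m).compl, ← lintegral_indicator (hA m).compl]
    refine lintegral_mono_ae ?_
    filter_upwards [hbd, coeFn_cut hB (absPow r z), coeFn_absPow r z] with a h1 h2 h3
    rw [h2]
    by_cases ha : a ∈ B
    · rw [Set.indicator_of_mem ha, Set.indicator_of_mem (show a ∈ (A m)ᶜ from ha.2), h3]
      exact h1.1
    · simp [ha]
  have hlt := (key.trans (mul_le_mul_right hint _)).trans_lt (hN m hm)
  rw [powNrm, hcut hB] at hlt
  have hlt := (ENNReal.ofReal_lt_ofReal_iff (Real.rpow_pos_of_pos hε r)).1 hlt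
  exact (Real.rpow_lt_rpow_iff (Y.nrm_nonneg _ hcarr) hε.le hr).1 hlt

end QuasiKothe

end

/-! ### Assembly of the factorization theorem. -/

theorem theorem2
    {Ω₁ Ω₂ : Type*} [MeasurableSpace Ω₁] [MeasurableSpace Ω₂]
    (μ : Measure Ω₁) (ν : Measure Ω₂) [SigmaFinite μ] [SigmaFinite ν]
    (X : QuasiKothe μ) (Y : QuasiKothe ν)
    {U V : Type*} [SMul ℝ≥0 U] [SMul ℝ≥0 V]
    (T : U →[ℝ≥0] V) (φ : U →[ℝ≥0] X.carrier) (ψ : V →[ℝ≥0] Y.carrier)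
    (r : ℝ) (hr : 0 < r) (hX : X.IsRConvex r) (hY : Y.IsRConcave r)
    (hT : ∀ (n : ℕ) (x : Fin n → U),
      Y.nrm (lrSum r fun k => (ψ (T (x k)) : Ω₂ →ₘ[ν] ℝ)) ≤
        X.nrm (lrSum r fun k => (φ (x k) : Ω₁ →ₘ[μ] ℝ))) :
    ∃ (Φ : X.power r hr →ₗ[ℝ] ℝ) (ω₂ : Ω₂ →ₘ[ν] ℝ),
      -- `Φ` is positive and satisfies its norm bound
      (∀ f : X.power r hr, 0 ≤ (f : Ω₁ →ₘ[μ] ℝ) → 0 ≤ Φ f) ∧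
      (∀ x : X.carrier, X.nrm x ≤ 1 → Φ (X.toPower r hr x) ^ (1 / r) ≤ X.convexityConst r) ∧
      -- `ω₂` is nonnegative and satisfies its norm bound
      0 ≤ ω₂ ∧
      (∀ y : Ω₂ →ₘ[ν] ℝ, eLpNorm y (ENNReal.ofReal r) ν ≤ 1 →
        Y.extNrm (absPow (1 / r) ω₂ * y) ≤ ENNReal.ofReal (Y.concavityConst r) ∧
        (Y.Complete → absPow (1 / r) ω₂ * y ∈ Y.carrier)) ∧
      -- the weighted inequality, with `a / 0 = ∞` for `a > 0` and `0 / 0 = 0`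
      (∀ x : U,
        ∫⁻ b, ENNReal.ofReal (|(ψ (T x) : Ω₂ →ₘ[ν] ℝ) b| ^ r) / ENNReal.ofReal (ω₂ b) ∂ν ≤
          ENNReal.ofReal (Φ (X.toPower r hr (φ x)))) ∧
      -- the functional is replaced by a weight
      (X.SigmaOrderContinuous →
        ∃ ω₁ : Ω₁ →ₘ[μ] ℝ, 0 ≤ ω₁ ∧
          (∀ x ∈ X.carrier, X.nrm x ≤ 1 →
            eLpNorm (absPow (1 / r) ω₁ * x : Ω₁ →ₘ[μ] ℝ) (ENNReal.ofReal r) μ ≤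
              ENNReal.ofReal (X.convexityConst r)) ∧
          ∀ x : U,
            ∫⁻ b, ENNReal.ofReal (|(ψ (T x) : Ω₂ →ₘ[ν] ℝ) b| ^ r) / ENNReal.ofReal (ω₂ b) ∂ν ≤
              ∫⁻ a, ENNReal.ofReal (|(φ x : Ω₁ →ₘ[μ] ℝ) a| ^ r * ω₁ a) ∂μ) := by
  have hcX := hX.convexConst
  have hcY := hY.concaveConst hr
  have hMX : 0 ≤ X.convexityConst r ^ r := Real.rpow_nonneg hcX.1 r
  have hMY : 0 ≤ Y.concavityConst r ^ r := Real.rpow_nonneg hcY.1 r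
  obtain ⟨I, Λ₁, Λ₂, hI, hIY, hbI, hΛ₁, hΛ₂, hup, hlow, hΛ⟩ :=
    X.exists_separating_functionals Y hr hcX hcY (fun x => absPow r (φ x : Ω₁ →ₘ[μ] ℝ))
      (fun x => absPow r (ψ (T x) : Ω₂ →ₘ[ν] ℝ))
      (fun x => X.absPow_mem_power r hr (φ x).2) (fun x => absPow_nonneg _ _)
      (fun x => Y.absPow_mem_power r hr (ψ (T x)).2) (fun x => absPow_nonneg _ _)
      (fun c hc x => by
        -- Scaling x by c^(1/r) scales |φ(x)|^r and |ψ(Tx)|^r by c.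
        have hc' : |((c ^ (1 / r)).toNNReal : ℝ)| ^ r = c := by
          rw [Real.coe_toNNReal _ (by positivity), abs_of_nonneg (by positivity),
            ← Real.rpow_mul hc.le, one_div_mul_cancel hr.ne', Real.rpow_one]
        refine ⟨(c ^ (1 / r)).toNNReal • x, ?_, ?_⟩
        · rw [map_smul]
          exact (absPow_smul r _ _).trans (by rw [hc'])
        · rw [map_smul, map_smul]
          exact (absPow_smul r _ _).trans (by rw [hc']))
      (fun n x => Real.rpow_le_rpow
        (Y.nrm_nonneg _ (Y.lrSum_mem r hr _ fun k => (ψ (T (x k))).2)) (hT n x) hr.le)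
  obtain ⟨ρ, hρ, hρI, hρY, hρex⟩ := Y.exists_weight_of_powNrm_le hr hI hIY hΛ₂ hMY hlow
  -- Where ρ = 0 the convention `∞.toReal = 0` gives ω₂ = 0; every ψ(Tx) vanishes there almost
  -- everywhere, so only 0 / 0 = 0 arises.
  have hω : AEStronglyMeasurable (fun b => ((ρ b)⁻¹).toReal) ν :=
    hρ.inv.ennreal_toReal.aestronglyMeasurable
  have hωae := coeFn_mk _ hω
  have hΦle : ∀ x ∈ X.carrier, X.nrm x ≤ 1 → Λ₁ (absPow r x) ≤ X.convexityConst r ^ r :=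
    fun x hx h1 => by
      refine (hup _ (X.absPow_mem_power r hr hx) (absPow_nonneg _ _)).trans ?_
      rw [X.powNrm_absPow hr hx]
      exact mul_le_of_le_one_right hMX (Real.rpow_le_one (X.nrm_nonneg _ hx) h1 hr.le)
  have hweight : ∀ x : U,
      ∫⁻ b, ENNReal.ofReal (|(ψ (T x) : Ω₂ →ₘ[ν] ℝ) b| ^ r) /
        ENNReal.ofReal ((AEEqFun.mk _ hω : Ω₂ →ₘ[ν] ℝ) b) ∂ν ≤
          ENNReal.ofReal (Λ₁ (absPow r (φ x : Ω₁ →ₘ[μ] ℝ))) := fun x => by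
    obtain ⟨h1, h2⟩ := hρI _ (hbI x) (absPow_nonneg _ _)
    refine le_trans (le_of_eq (lintegral_congr_ae ?_))
      (h2.trans (ENNReal.ofReal_le_ofReal (hΛ x)))
    filter_upwards [h1, hωae, coeFn_absPow r (ψ (T x) : Ω₂ →ₘ[ν] ℝ)] with b k1 k2 k3
    rw [k2, ← k3]
    by_cases hb : absPow r (ψ (T x) : Ω₂ →ₘ[ν] ℝ) b = 0
    · simp [hb]
    · obtain ⟨k4, k5⟩ := k1 hb
      rw [ENNReal.ofReal_toReal (ENNReal.inv_ne_top.2 k4), div_eq_mul_inv, inv_inv, mul_comm]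
  refine ⟨Λ₁.comp (X.power r hr).subtype, AEEqFun.mk _ hω, fun f h0 => hΛ₁ _ f.2 h0, ?_, ?_, ?_,
    hweight, ?_⟩
  · intro x hx
    refine (Real.rpow_le_rpow (hΛ₁ _ (X.absPow_mem_power r hr x.2) (absPow_nonneg _ _))
      (hΦle x x.2 hx) (by positivity)).trans (le_of_eq ?_)
    rw [← Real.rpow_mul hcX.1, mul_one_div_cancel hr.ne', Real.rpow_one]
  · rw [nonneg_iff]
    filter_upwards [hωae] with b hb
    rw [hb]
    exact ENNReal.toReal_nonneg
  · intro y hy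
    exact ⟨Y.extNrm_weight_mul_le hr hcY.1 hρY hω hy,
      fun hcomp => Y.weight_mul_mem hr hρY hρex hω hy hcomp⟩
  · intro hoc
    obtain ⟨σ, hσ, hσX⟩ := hoc.exists_weight hr hΛ₁ hup
    have hτ : AEStronglyMeasurable (fun a => (σ a).toReal) μ :=
      hσ.ennreal_toReal.aestronglyMeasurable
    have hint : ∀ x ∈ X.carrier,
        ∫⁻ a, ENNReal.ofReal (|x a| ^ r * (AEEqFun.mk _ hτ : Ω₁ →ₘ[μ] ℝ) a) ∂μ =
          ENNReal.ofReal (Λ₁ (absPow r x)) := fun x hx => by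
      obtain ⟨h1, h2⟩ := hσX _ (X.absPow_mem_power r hr hx) (absPow_nonneg _ _)
      rw [← h2]
      refine lintegral_congr_ae ?_
      filter_upwards [h1, coeFn_mk _ hτ, coeFn_absPow r x] with a k1 k2 k3
      rw [k2, ← k3]
      by_cases ha : absPow r x a = 0
      · simp [ha]
      · have hnn : 0 ≤ absPow r x a := by rw [k3]; positivity
        rw [ENNReal.ofReal_mul hnn, ENNReal.ofReal_toReal (k1 ha), mul_comm]
    refine ⟨AEEqFun.mk _ hτ, ?_, fun x hx h1 => ?_, fun x => ?_⟩
    · rw [nonneg_iff]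
      filter_upwards [coeFn_mk _ hτ] with a ha
      rw [ha]
      exact ENNReal.toReal_nonneg
    · rw [eLpNorm_ofReal_eq_lintegral hr]
      have : ∫⁻ a, ENNReal.ofReal (|(absPow (1 / r) (AEEqFun.mk _ hτ) * x : Ω₁ →ₘ[μ] ℝ) a| ^ r) ∂μ
          = ENNReal.ofReal (Λ₁ (absPow r x)) := by
        rw [← hint x hx]
        refine lintegral_congr_ae ?_
        filter_upwards [abs_absPow_mul_rpow hr (AEEqFun.mk _ hτ : Ω₁ →ₘ[μ] ℝ) x, coeFn_mk _ hτ]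
          with a k1 k2
        rw [k1, k2, abs_of_nonneg ENNReal.toReal_nonneg, mul_comm]
      rw [this]
      calc ENNReal.ofReal (Λ₁ (absPow r x)) ^ (1 / r)
          ≤ ENNReal.ofReal (X.convexityConst r ^ r) ^ (1 / r) := by
            gcongr
            exact hΦle x hx h1
        _ = ENNReal.ofReal (X.convexityConst r) := by
            rw [ENNReal.ofReal_rpow_of_nonneg hMX (by positivity), ← Real.rpow_mul hcX.1,
              mul_one_div_cancel hr.ne', Real.rpow_one]
    · rw [hint _ (φ x).2]
      exact hweight x
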